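/- Let $d\ge 2$. A state of a $2\otimes d$ system is a positive semidefinite operator of trace one on $\mathbb{C}^2\otimes\mathbb{C}^d$. A state is separable if it is a finite convex combination of product states $\alpha\otimes\beta$, where $\alpha$ is a state on $\mathbb{C}^2$ and $\beta$ a state on $\mathbb{C}^d$; it is absolutely separable if $U\rho U^\dagger$ is separable for every unitary operator $U$ on $\mathbb{C}^2\otimes\mathbb{C}^d$. Let $\mathbf{AS}$ be the set of absolutely separable states; its interior and boundary are taken relative to the set of all states of the system, with the usual topology. Let $\rho\in\mathbf{AS}$ be different from the maximally mixed state $\mathbb{I}/(2d)$, and let $\lambda_1\ge\lambda_2\ge\dots\ge\lambda_{2d}$ be the eigenvalues of $\rho$, counted with multiplicity. If $$\lambda_1-\lambda_{2d-1}<2\sqrt{\lambda_{2d-2}\,\lambda_{2d}},$$ then there are a boundary point $\sigma$ of $\mathbf{AS}$ that belongs to $\mathbf{AS}$ and a real number $t$ with $0<t<1$ such that $$\rho=t\,\frac{\mathbb{I}}{2d}+(1-t)\,\sigma .$$ Moreover, $\rho$ is an interior point of $\mathbf{AS}$. -/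

import Mathlib

open scoped Kronecker Matrix ComplexOrder

/-- The states (density matrices) of a finite-dimensional quantum system with orthonormal
basis indexed by `n`: positive semidefinite complex matrices of trace one. As a subtype of the
matrices, the set of states carries the usual (Euclidean) topology. -/
abbrev QState (n : Type) [Fintype n] : Type :=
  {ρ : Matrix n n ℂ // ρ.PosSemidef ∧ ρ.trace = 1}

/-- The conjugation `U ρ U†` of a state by a unitary. -/
def QState.conj {n : Type} [Fintype n] [DecidableEq n] (U : Matrix.unitaryGroup n ℂ)
    (ρ : QState n) : QState n :=
  ⟨(U : Matrix n n ℂ) * ρ.1 * (U : Matrix n n ℂ)ᴴ,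
    ρ.2.1.mul_mul_conjTranspose_same _, by
      rw [Matrix.trace_mul_cycle, ← Matrix.star_eq_conjTranspose,
        Matrix.UnitaryGroup.star_mul_self, Matrix.one_mul, ρ.2.2]⟩

/-- A bipartite state is separable if it is a (finite) convex combination of product states
`α ⊗ β`, where `α` and `β` are states of the two subsystems. -/
def QIsSeparable {m n : Type} [Fintype m] [Fintype n] (ρ : QState (m × n)) : Prop :=
  ρ.1 ∈ convexHull ℝ
    {τ : Matrix (m × n) (m × n) ℂ | ∃ (α : QState m) (β : QState n), τ = α.1 ⊗ₖ β.1}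

/-- The set of absolutely separable states in `2 ⊗ d`: the states that remain separable under
every global unitary. It is a subset of the space of all states of the system. -/
def absSep (d : ℕ) : Set (QState (Fin 2 × Fin d)) :=
  {ρ | ∀ U : Matrix.unitaryGroup (Fin 2 × Fin d) ℂ, QIsSeparable (ρ.conj U)}

/-- The maximally mixed state `𝟙 / (2d)` of a `2 ⊗ d` system. -/
noncomputable def maxMixed (d : ℕ) : Matrix (Fin 2 × Fin d) (Fin 2 × Fin d) ℂ :=
  ((2 * d : ℝ)⁻¹) • 1

/-- The `2d` eigenvalues of a `2 ⊗ d` state, with multiplicity, in decreasing order. The index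
starts at `0`, so that the eigenvalue usually written `λ_k` is `decEig ρ (k - 1)`. -/
noncomputable def decEig {d : ℕ} (ρ : QState (Fin 2 × Fin d)) (k : Fin (2 * d)) : ℝ :=
  ρ.2.1.isHermitian.eigenvalues₀ (Fin.cast (by simp) k)

/-
Let `l` be the largest and `b ≥ c ≥ e` the three smallest eigenvalues of a Hermitian `M` on
`ℂ² ⊗ ℂᵈ`, and suppose `l < c + 2 √(b e)`. For a vector with Schmidt coefficients `p ≥ q`, the
expectation of the partial transpose of `M` is `p² ⟪g₀⟫ + q² ⟪g₁⟫ + p q (⟪g₂⟫ - ⟪g₃⟫)`, where `g` is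
orthonormal and `⟪gᵢ⟫` is the expectation of `M` at `gᵢ`; by Ky Fan's inequalities and AM-GM it is
positive.

Write `M` in blocks `A, B, B†, C`. If the lowest eigenvectors `v` of `A` and `w` of `C` make equal
angles with the top singular pair `x, y` of `B`, then positivity at a vector built from `v`, `x`,
`w`, `y` gives `‖B‖² < λ_min(A) λ_min(C)`, and such an `M` is separable: after subtracting the
separable operator `(A - λ_min(A)) ⊕ (C - λ_min(C))` and rescaling, the diagonal blocks are `1` and
a local filter makes all blocks Hermitian. The angles can be matched by rotating the basis of `ℂ²`,
because a quarter turn exchanges the two angles and the choices of top vectors form a connected set.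

The hypothesis is open and invariant under unitaries, so `ρ` is an interior point of the absolutely
separable states. On the ray from `𝟙 / (2d)` through `ρ`, let `σ` be the last absolutely separable
state. Interior points are positive definite, since a singular state whose kernel contains a product
vector, as a suitable unitary arranges, is pushed out of the separable states by an arbitrarily
small perturbation; the ray could therefore be continued beyond `σ` if `σ` were interior.
-/

section KyFan

variable {H ι κ : Type*} [NormedAddCommGroup H] [InnerProductSpace ℂ H] [Fintype ι] [Fintype κ]
  {T : H →L[ℂ] H} {μ : ι → ℝ}

lemma inner_apply_eq_sum_of_eigenbasis (v : OrthonormalBasis ι ℂ H)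
    (hT : ∀ i, T (v i) = (μ i : ℂ) • v i) (x y : H) :
    inner ℂ (T x) y = ∑ i, (μ i : ℂ) * (inner ℂ x (v i) * inner ℂ (v i) y) := by
  nth_rw 1 [← v.sum_repr' x]
  simp only [map_sum, map_smul, hT, sum_inner, inner_smul_left, inner_conj_symm,
    Complex.conj_ofReal]
  exact Finset.sum_congr rfl fun i _ => by ring

lemma isSymmetric_of_eigenbasis (v : OrthonormalBasis ι ℂ H)
    (hT : ∀ i, T (v i) = (μ i : ℂ) • v i) : (T : H →ₗ[ℂ] H).IsSymmetric := fun x y => by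
  rw [ContinuousLinearMap.coe_coe, ← inner_conj_symm x,
    inner_apply_eq_sum_of_eigenbasis v hT, inner_apply_eq_sum_of_eigenbasis v hT, map_sum]
  refine Finset.sum_congr rfl fun i _ => ?_
  simp only [map_mul, inner_conj_symm, Complex.conj_ofReal]
  ring

lemma reApplyInnerSelf_eq_sum_of_eigenbasis (v : OrthonormalBasis ι ℂ H)
    (hT : ∀ i, T (v i) = (μ i : ℂ) • v i) (x : H) :
    T.reApplyInnerSelf x = ∑ i, μ i * ‖inner ℂ (v i) x‖ ^ 2 := by
  rw [ContinuousLinearMap.reApplyInnerSelf, inner_apply_eq_sum_of_eigenbasis v hT]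
  simp only [← inner_conj_symm x, Complex.conj_mul']
  norm_cast

lemma sum_eigenvalues_le_sum_reApplyInnerSelf (v : OrthonormalBasis ι ℂ H)
    (hT : ∀ i, T (v i) = (μ i : ℂ) • v i) {u : κ → H} (hu : Orthonormal ℂ u) {s : Finset ι}
    (hs : s.card = Fintype.card κ) {m : ℝ} (h_le : ∀ i ∈ s, μ i ≤ m) (h_ge : ∀ i ∉ s, m ≤ μ i) :
    ∑ i ∈ s, μ i ≤ ∑ k, T.reApplyInnerSelf (u k) := by
  classical
  set w : ι → ℝ := fun i => ∑ k, ‖inner ℂ (v i) (u k)‖ ^ 2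
  have hw_nonneg i : 0 ≤ w i := by positivity
  have hw_le_one i : w i ≤ 1 := by
    simpa only [w, norm_inner_symm (u _), v.orthonormal.1 i, one_pow] using
      hu.sum_inner_products_le (v i) (s := Finset.univ)
  have hw_sum : ∑ i, w i = s.card := by
    simp only [w, hs]
    rw [Finset.sum_comm]
    simp [v.sum_sq_norm_inner_right, hu.1]
  have h_quad : ∑ k, T.reApplyInnerSelf (u k) = ∑ i, μ i * w i := by
    simp only [reApplyInnerSelf_eq_sum_of_eigenbasis v hT, w, Finset.mul_sum]
    exact Finset.sum_comm
  have h_gap : 0 ≤ ∑ i, (μ i - m) * (w i - if i ∈ s then 1 else 0) := by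
    refine Finset.sum_nonneg fun i _ => ?_
    split_ifs with hi
    · exact mul_nonneg_of_nonpos_of_nonpos (sub_nonpos.2 (h_le i hi)) (sub_nonpos.2 (hw_le_one i))
    · exact mul_nonneg (sub_nonneg.2 (h_ge i hi)) (by simpa using hw_nonneg i)
  have h_expand : ∑ i, (μ i - m) * (w i - if i ∈ s then 1 else 0) =
      ∑ i, μ i * w i - ∑ i ∈ s, μ i := by
    simp only [sub_mul, mul_sub, Finset.sum_sub_distrib, ← Finset.mul_sum, hw_sum, mul_ite, mul_one,
      mul_zero, Finset.sum_ite_mem, Finset.univ_inter, Finset.sum_const, nsmul_eq_mul]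
    ring
  linarith

end KyFan

section EigenvalueBounds

variable {H : Type*} [NormedAddCommGroup H] [InnerProductSpace ℂ H] {T : H →L[ℂ] H} {l b c e : ℝ}

/-- `T` is a self-adjoint operator whose largest eigenvalue is at most `l` and whose sums of the
one, two and three smallest eigenvalues are at least `e`, `c + e` and `b + c + e`. The bounds are
stated variationally, which makes them stable under perturbation and unitary conjugation. -/
structure EigenvalueBounds (T : H →L[ℂ] H) (l b c e : ℝ) : Prop where
  isSymmetric : (T : H →ₗ[ℂ] H).IsSymmetric
  le_top : ∀ u : H, ‖u‖ = 1 → T.reApplyInnerSelf u ≤ l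
  le_one : ∀ u : H, ‖u‖ = 1 → e ≤ T.reApplyInnerSelf u
  le_two : ∀ u : Fin 2 → H, Orthonormal ℂ u → c + e ≤ ∑ k, T.reApplyInnerSelf (u k)
  le_three : ∀ u : Fin 3 → H, Orthonormal ℂ u → b + c + e ≤ ∑ k, T.reApplyInnerSelf (u k)

namespace EigenvalueBounds

lemma of_eigenbasis {N : ℕ} (v : OrthonormalBasis (Fin N) ℂ H) {μ : Fin N → ℝ}
    (hμ : Antitone μ) (hT : ∀ i, T (v i) = (μ i : ℂ) • v i) {i j k n : Fin N}
    (hi : (i : ℕ) = 0) (hj : (j : ℕ) + 3 = N) (hk : (k : ℕ) + 2 = N) (hn : (n : ℕ) + 1 = N) :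
    EigenvalueBounds T (μ i) (μ j) (μ k) (μ n) where
  isSymmetric := isSymmetric_of_eigenbasis v hT
  le_top u hu := by
    rw [reApplyInnerSelf_eq_sum_of_eigenbasis v hT]
    calc ∑ a, μ a * ‖inner ℂ (v a) u‖ ^ 2 ≤ ∑ a, μ i * ‖inner ℂ (v a) u‖ ^ 2 := by
          gcongr with a; exact hμ (Fin.le_def.2 (by lia))
      _ = μ i := by rw [← Finset.mul_sum, v.sum_sq_norm_inner_right, hu, one_pow, mul_one]
  le_one u hu := by
    have h := sum_eigenvalues_le_sum_reApplyInnerSelf v hT (s := {n}) (m := μ n)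
      (u := fun _ : Unit => u) ⟨fun _ => hu, fun a b hab => (hab rfl).elim⟩ (by simp) (by simp)
      (fun a _ => hμ (Fin.le_def.2 (by lia)))
    simpa using h
  le_two u hu := by
    have hkn : k ≠ n := by lia
    have h := sum_eigenvalues_le_sum_reApplyInnerSelf v hT (s := {k, n}) (m := μ k) hu
      (by simp [hkn]) (by simpa using hμ (Fin.le_def.2 (by lia)))
      (fun a ha => hμ (Fin.le_def.2 (by
        simp only [Finset.mem_insert, Finset.mem_singleton] at ha; lia)))
    rwa [Finset.sum_pair hkn] at h
  le_three u hu := by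
    have hkn : k ≠ n := by lia
    have hj' : j ∉ ({k, n} : Finset (Fin N)) := by
      simp only [Finset.mem_insert, Finset.mem_singleton]; lia
    have h := sum_eigenvalues_le_sum_reApplyInnerSelf v hT (s := {j, k, n}) (m := μ j) hu
      (by simp [hkn, hj'])
      (by simpa using ⟨hμ (Fin.le_def.2 (by lia)), hμ (Fin.le_def.2 (by lia))⟩)
      (fun a ha => hμ (Fin.le_def.2 (by
        simp only [Finset.mem_insert, Finset.mem_singleton] at ha; lia)))
    rwa [Finset.sum_insert hj', Finset.sum_pair hkn, ← add_assoc] at h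

lemma perturb (hT : EigenvalueBounds T l b c e) {T' : H →L[ℂ] H}
    (hT' : (T' : H →ₗ[ℂ] H).IsSymmetric) {ε : ℝ} (hε : ‖T' - T‖ ≤ ε) :
    EigenvalueBounds T' (l + ε) (b - ε) (c - ε) (e - ε) := by
  have h_close u (hu : ‖u‖ = 1) : |T'.reApplyInnerSelf u - T.reApplyInnerSelf u| ≤ ε := by
    calc |T'.reApplyInnerSelf u - T.reApplyInnerSelf u|
        = |(inner ℂ ((T' - T) u) u).re| := by
          simp [ContinuousLinearMap.reApplyInnerSelf]
      _ ≤ ‖inner ℂ ((T' - T) u) u‖ := Complex.abs_re_le_norm _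
      _ ≤ ‖(T' - T) u‖ * ‖u‖ := norm_inner_le_norm _ _
      _ ≤ ‖T' - T‖ := by rw [hu, mul_one]; exact (T' - T).unit_le_opNorm u hu.le
      _ ≤ ε := hε
  have h_ge u (hu : ‖u‖ = 1) : T.reApplyInnerSelf u - ε ≤ T'.reApplyInnerSelf u := by
    linarith [(abs_le.1 (h_close u hu)).1]
  refine ⟨hT', fun u hu => ?_, fun u hu => ?_, fun u hu => ?_, fun u hu => ?_⟩
  · linarith [hT.le_top u hu, (abs_le.1 (h_close u hu)).2]
  · linarith [hT.le_one u hu, h_ge u hu]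
  · have h := hT.le_two u hu
    rw [Fin.sum_univ_two] at h ⊢
    linarith [h_ge _ (hu.1 0), h_ge _ (hu.1 1)]
  · have h := hT.le_three u hu
    rw [Fin.sum_univ_three] at h ⊢
    linarith [h_ge _ (hu.1 0), h_ge _ (hu.1 1), h_ge _ (hu.1 2)]

lemma of_isometry (hT : EigenvalueBounds T l b c e) {H' : Type*} [NormedAddCommGroup H']
    [InnerProductSpace ℂ H'] {T' : H' →L[ℂ] H'} (W : H' →ₗᵢ[ℂ] H)
    (hT' : ∀ x y, inner ℂ (T' x) y = inner ℂ (T (W x)) (W y)) : EigenvalueBounds T' l b c e := by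
  have h_quad u : T'.reApplyInnerSelf u = T.reApplyInnerSelf (W u) := by
    simp only [ContinuousLinearMap.reApplyInnerSelf, hT']
  refine ⟨fun x y => ?_, fun u hu => ?_, fun u hu => ?_, fun u hu => ?_, fun u hu => ?_⟩
  · have h := hT.isSymmetric (W x) (W y)
    simp only [ContinuousLinearMap.coe_coe] at h ⊢
    rw [hT', h, ← inner_conj_symm, ← hT', inner_conj_symm]
  · exact h_quad u ▸ hT.le_top _ (by rw [W.norm_map, hu])
  · exact h_quad u ▸ hT.le_one _ (by rw [W.norm_map, hu])
  · simpa only [h_quad, Function.comp_apply] using hT.le_two _ (hu.comp_linearIsometry W)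
  · simpa only [h_quad, Function.comp_apply] using hT.le_three _ (hu.comp_linearIsometry W)

end EigenvalueBounds

end EigenvalueBounds

section SingularValues

/-- The matrix of the rotation of the plane by the angle `-θ`; its rows are the standard basis
rotated by `θ`. -/
noncomputable def rotationMatrix (θ : ℝ) : Matrix (Fin 2) (Fin 2) ℝ :=
  !![θ.cos, θ.sin; -θ.sin, θ.cos]

lemma rotationMatrix_mul_transpose (θ : ℝ) : rotationMatrix θ * (rotationMatrix θ)ᵀ = 1 := by
  ext i j
  fin_cases i <;> fin_cases j <;>
    simp [rotationMatrix, Matrix.mul_apply, Fin.sum_univ_two] <;> linarith [θ.cos_sq_add_sin_sq]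

lemma exists_svd_fin_two (m : Matrix (Fin 2) (Fin 2) ℝ) :
    ∃ R S : Matrix (Fin 2) (Fin 2) ℝ, ∃ p q : ℝ, R * Rᵀ = 1 ∧ S * Sᵀ = 1 ∧ 0 ≤ q ∧ q ≤ p ∧
      m = Rᵀ * Matrix.diagonal ![p, q] * S := by
  -- As a real-linear map of `ℂ`, `m` is `z ↦ μ z + ν z̄`, with singular values `‖μ‖ ± ‖ν‖`.
  let μ : ℂ := ⟨(m 0 0 + m 1 1) / 2, (m 1 0 - m 0 1) / 2⟩
  let ν : ℂ := ⟨(m 0 0 - m 1 1) / 2, (m 1 0 + m 0 1) / 2⟩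
  obtain ⟨θ, φ, hμ, hν⟩ : ∃ θ φ : ℝ, μ.arg = θ - φ ∧ ν.arg = θ + φ :=
    ⟨(μ.arg + ν.arg) / 2, (ν.arg - μ.arg) / 2, by ring, by ring⟩
  have hμ_re : ‖μ‖ * (θ.cos * φ.cos + θ.sin * φ.sin) = (m 0 0 + m 1 1) / 2 := by
    rw [← Real.cos_sub, ← hμ]; exact Complex.norm_mul_cos_arg μ
  have hμ_im : ‖μ‖ * (θ.sin * φ.cos - θ.cos * φ.sin) = (m 1 0 - m 0 1) / 2 := by
    rw [← Real.sin_sub, ← hμ]; exact Complex.norm_mul_sin_arg μ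
  have hν_re : ‖ν‖ * (θ.cos * φ.cos - θ.sin * φ.sin) = (m 0 0 - m 1 1) / 2 := by
    rw [← Real.cos_add, ← hν]; exact Complex.norm_mul_cos_arg ν
  have hν_im : ‖ν‖ * (θ.sin * φ.cos + θ.cos * φ.sin) = (m 1 0 + m 0 1) / 2 := by
    rw [← Real.sin_add, ← hν]; exact Complex.norm_mul_sin_arg ν
  obtain ⟨ε, hε, h_abs⟩ : ∃ ε : ℝ, ε ^ 2 = 1 ∧ ε * |‖μ‖ - ‖ν‖| = ‖μ‖ - ‖ν‖ := by
    rcases abs_choice (‖μ‖ - ‖ν‖) with h | h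
    · exact ⟨1, by norm_num, by rw [h]; ring⟩
    · exact ⟨-1, by norm_num, by rw [h]; ring⟩
  have h_refl : Matrix.diagonal ![1, ε] * (Matrix.diagonal ![1, ε])ᵀ = 1 := by
    rw [Matrix.diagonal_transpose, Matrix.diagonal_mul_diagonal, Matrix.diagonal_eq_one]
    ext i
    fin_cases i <;> simp [← sq, hε]
  refine ⟨rotationMatrix θ, Matrix.diagonal ![1, ε] * rotationMatrix φ, ‖μ‖ + ‖ν‖, |‖μ‖ - ‖ν‖|,
    rotationMatrix_mul_transpose θ, ?_, abs_nonneg _,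
    abs_le.2 ⟨by linarith [norm_nonneg μ], by linarith [norm_nonneg ν]⟩, ?_⟩
  · rw [Matrix.transpose_mul, Matrix.mul_assoc, ← Matrix.mul_assoc (rotationMatrix φ),
      rotationMatrix_mul_transpose, Matrix.one_mul, h_refl]
  · generalize ‖μ‖ = P at *
    generalize ‖ν‖ = N at *
    ext i j
    fin_cases i <;> fin_cases j <;>
      simp [rotationMatrix, Matrix.mul_apply, Fin.sum_univ_two] <;> grind

end SingularValues

section OrthonormalFamilies

variable {H : Type*} [NormedAddCommGroup H] [InnerProductSpace ℂ H]

lemma orthonormal_sum_smul {ι κ : Type*} [Fintype ι] [DecidableEq κ] {u : ι → H}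
    (hu : Orthonormal ℂ u) {A : Matrix κ ι ℝ} (hA : A * Aᵀ = 1) :
    Orthonormal ℂ fun k => ∑ i, (A k i : ℂ) • u i := by
  refine orthonormal_iff_ite.2 fun k k' => ?_
  rw [hu.inner_sum]
  simp only [Complex.conj_ofReal, ← Complex.ofReal_mul, ← Complex.ofReal_sum]
  have h : ∑ i, A k i * A k' i = (1 : Matrix κ κ ℝ) k k' := by
    rw [← hA, Matrix.mul_apply]; simp only [Matrix.transpose_apply]
  rw [h, Matrix.one_apply, apply_ite Complex.ofReal, Complex.ofReal_one, Complex.ofReal_zero]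

lemma exists_norm_eq_one_smul_eq [Nontrivial H] (x : H) : ∃ u : H, ‖u‖ = 1 ∧ x = (‖x‖ : ℂ) • u := by
  by_cases hx : x = 0
  · obtain ⟨u, hu⟩ := exists_norm_eq H zero_le_one
    exact ⟨u, hu, by simp [hx]⟩
  · refine ⟨(‖x‖⁻¹ : ℂ) • x, norm_smul_inv_norm hx, ?_⟩
    rw [smul_smul, mul_inv_cancel₀ (by simpa using hx), one_smul]

lemma exists_orthonormal_pair_of_inner_eq (hH : 1 < Module.finrank ℂ H) {v x : H} {γ : ℝ}
    (hv : ‖v‖ = 1) (hx : ‖x‖ = 1) (hγ : inner ℂ v x = γ) :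
    ∃ u, Orthonormal ℂ ![v, u] ∧ x = (γ : ℂ) • v + (√(1 - γ ^ 2) : ℂ) • u := by
  have : Nontrivial (ℂ ∙ v)ᗮ := by
    refine Submodule.nontrivial_iff_ne_bot.2 fun h => ?_
    have h_span := finrank_span_singleton (K := ℂ) (v := v) (by rintro rfl; simp at hv)
    rw [Submodule.orthogonal_eq_bot_iff.1 h, finrank_top] at h_span
    exact hH.ne' h_span
  have hr : x - (γ : ℂ) • v ∈ (ℂ ∙ v)ᗮ := by
    rw [Submodule.mem_orthogonal_singleton_iff_inner_right, inner_sub_right, inner_smul_right, hγ,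
      inner_self_eq_one_of_norm_eq_one hv, mul_one, sub_self]
  obtain ⟨u, hu, hxu⟩ := exists_norm_eq_one_smul_eq (⟨_, hr⟩ : (ℂ ∙ v)ᗮ)
  have hvu : inner ℂ v (u : H) = 0 := Submodule.mem_orthogonal_singleton_iff_inner_right.1 u.2
  have h_norm : ‖x - (γ : ℂ) • v‖ ^ 2 = 1 - γ ^ 2 := by
    have h := norm_add_sq_eq_norm_sq_add_norm_sq_of_inner_eq_zero (𝕜 := ℂ) ((γ : ℂ) • v)
      (x - (γ : ℂ) • v) (by
        rw [inner_smul_left, Submodule.mem_orthogonal_singleton_iff_inner_right.1 hr, mul_zero])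
    rw [add_sub_cancel, hx, norm_smul, hv, Complex.norm_real, Real.norm_eq_abs, mul_one] at h
    linarith [sq_abs γ]
  refine ⟨u, ?_, ?_⟩
  · simp [orthonormal_vecCons_iff, hv, hvu, show ‖(u : H)‖ = 1 from hu]
  · rw [← h_norm, Real.sqrt_sq (norm_nonneg _), ← sub_eq_iff_eq_add']
    simpa using congrArg Subtype.val hxu

end OrthonormalFamilies

section PartialTransposeForm

variable {H : Type*} [NormedAddCommGroup H] [InnerProductSpace ℂ H] {T : H →L[ℂ] H}

/-- The expectation of the partial transpose of `T` at the real vector `∑ i j, m i j • e (i, j)`,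
where `e` is a family of vectors indexed like a product basis. -/
noncomputable def partialTransposeForm (T : H →L[ℂ] H) (e : Fin 2 × Fin 2 → H)
    (m : Matrix (Fin 2) (Fin 2) ℝ) : ℝ :=
  ∑ i, ∑ j, ∑ k, ∑ l, m i j * m k l * (inner ℂ (T (e (i, l))) (e (k, j))).re

lemma re_inner_apply_sum_smul {ι : Type*} [Fintype ι] (T : H →L[ℂ] H) (u : ι → H) (x y : ι → ℝ) :
    (inner ℂ (T (∑ i, (x i : ℂ) • u i)) (∑ j, (y j : ℂ) • u j)).re =
      ∑ i, ∑ j, x i * y j * (inner ℂ (T (u i)) (u j)).re := by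
  simp only [map_sum, map_smul, sum_inner, inner_sum, inner_smul_left, inner_smul_right,
    Complex.re_sum, Complex.conj_ofReal, Complex.re_ofReal_mul]
  rw [Finset.sum_comm]
  simp only [Finset.mul_sum]
  exact Finset.sum_congr rfl fun i _ => Finset.sum_congr rfl fun j _ => by ring

lemma partialTransposeForm_transpose_mul_mul (T : H →L[ℂ] H) (e : Fin 2 × Fin 2 → H)
    (R S : Matrix (Fin 2) (Fin 2) ℝ) (p q : ℝ) :
    partialTransposeForm T e (Rᵀ * Matrix.diagonal ![p, q] * S) =
      partialTransposeForm T (fun a => ∑ i, (((R ⊗ₖ S) a i : ℝ) : ℂ) • e i)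
        (Matrix.diagonal ![p, q]) := by
  simp only [partialTransposeForm, re_inner_apply_sum_smul]
  simp [Matrix.mul_apply, Fintype.sum_prod_type, Fin.sum_univ_two]
  ring

lemma reApplyInnerSelf_real_smul (T : H →L[ℂ] H) (r : ℝ) (x : H) :
    T.reApplyInnerSelf ((r : ℂ) • x) = r ^ 2 * T.reApplyInnerSelf x := by
  simpa using T.reApplyInnerSelf_smul x (c := (r : ℂ))

lemma reApplyInnerSelf_add_sub_reApplyInnerSelf_sub (T : H →L[ℂ] H) (x y : H) :
    T.reApplyInnerSelf (x + y) - T.reApplyInnerSelf (x - y) =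
      2 * ((inner ℂ (T x) y).re + (inner ℂ (T y) x).re) := by
  simp only [ContinuousLinearMap.reApplyInnerSelf, map_add, map_sub, inner_add_left,
    inner_add_right, inner_sub_left, inner_sub_right, RCLike.re_to_complex]
  ring

/-- The eigenvectors of the swap of two qubits, relative to the product frame `e`: `e₀₀` and `e₁₁`,
followed by the triplet and singlet combinations of `e₀₁` and `e₁₀`. The form of a diagonal matrix
under partial transposition is a combination of expectations at these four vectors. -/
noncomputable def bellFrame (e : Fin 2 × Fin 2 → H) : Fin 4 → H :=
  ![e (0, 0), e (1, 1), (((√2)⁻¹ : ℝ) : ℂ) • (e (0, 1) + e (1, 0)),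
    (((√2)⁻¹ : ℝ) : ℂ) • (e (0, 1) - e (1, 0))]

lemma orthonormal_bellFrame {e : Fin 2 × Fin 2 → H} (he : Orthonormal ℂ e) :
    Orthonormal ℂ (bellFrame e) := by
  let A : Matrix (Fin 4) (Fin 4) ℝ :=
    !![1, 0, 0, 0; 0, 1, 0, 0; 0, 0, (√2)⁻¹, (√2)⁻¹; 0, 0, (√2)⁻¹, -(√2)⁻¹]
  have hA : A * Aᵀ = 1 := by
    ext i j
    fin_cases i <;> fin_cases j <;>
      simp [A, Matrix.mul_apply, Fin.sum_univ_four, ← mul_inv] <;> norm_num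
  convert orthonormal_sum_smul (he.comp ![(0, 0), (1, 1), (0, 1), (1, 0)] (by decide)) hA using 1
  ext k
  fin_cases k <;> simp [A, bellFrame, Fin.sum_univ_four, smul_add, sub_eq_add_neg,
    -Complex.ofReal_inv]

lemma partialTransposeForm_diagonal (T : H →L[ℂ] H) (e : Fin 2 × Fin 2 → H) (p q : ℝ) :
    partialTransposeForm T e (Matrix.diagonal ![p, q]) =
      p ^ 2 * T.reApplyInnerSelf (bellFrame e 0) + q ^ 2 * T.reApplyInnerSelf (bellFrame e 1) +
        p * q * (T.reApplyInnerSelf (bellFrame e 2) - T.reApplyInnerSelf (bellFrame e 3)) := by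
  have h := reApplyInnerSelf_add_sub_reApplyInnerSelf_sub T (e (0, 1)) (e (1, 0))
  have h2 : T.reApplyInnerSelf (bellFrame e 2) - T.reApplyInnerSelf (bellFrame e 3) =
      (inner ℂ (T (e (0, 1))) (e (1, 0))).re + (inner ℂ (T (e (1, 0))) (e (0, 1))).re := by
    simp only [bellFrame, Matrix.cons_val, reApplyInnerSelf_real_smul,
      ← mul_sub, h, inv_pow, Real.sq_sqrt zero_le_two]
    ring
  rw [h2]
  simp [partialTransposeForm, Fin.sum_univ_two, bellFrame, ContinuousLinearMap.reApplyInnerSelf]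
  ring

variable {l b c e : ℝ}

namespace EigenvalueBounds

lemma weighted_sum_pos (hT : EigenvalueBounds T l b c e) (hb : 0 ≤ b) (he : 0 < e)
    (hl : l < c + 2 * √(b * e)) {p q : ℝ} (hp : 0 < p) (hq : 0 ≤ q) (hqp : q ≤ p) {g : Fin 4 → H}
    (hg : Orthonormal ℂ g) :
    0 < p ^ 2 * T.reApplyInnerSelf (g 0) + q ^ 2 * T.reApplyInnerSelf (g 1) +
      p * q * (T.reApplyInnerSelf (g 2) - T.reApplyInnerSelf (g 3)) := by
  have h_one := hT.le_one (g 0) (hg.1 0)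
  have h_two : c + e ≤ T.reApplyInnerSelf (g 0) + T.reApplyInnerSelf (g 2) := by
    simpa [Fin.sum_univ_two] using hT.le_two (g ∘ ![0, 2]) (hg.comp _ (by decide))
  have h_three : b + c + e ≤
      T.reApplyInnerSelf (g 0) + T.reApplyInnerSelf (g 1) + T.reApplyInnerSelf (g 2) := by
    simpa [Fin.sum_univ_three] using hT.le_three (g ∘ ![0, 1, 2]) (hg.comp _ (by decide))
  have h_top := hT.le_top (g 3) (hg.1 3)
  have h_weights : p ^ 2 * e + q ^ 2 * b + p * q * (c - l) ≤
      p ^ 2 * T.reApplyInnerSelf (g 0) + q ^ 2 * T.reApplyInnerSelf (g 1) +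
        p * q * (T.reApplyInnerSelf (g 2) - T.reApplyInnerSelf (g 3)) := by
    have h1 := mul_nonneg (mul_nonneg hp.le (sub_nonneg.2 hqp)) (sub_nonneg.2 h_one)
    have h2 := mul_nonneg (mul_nonneg hq (sub_nonneg.2 hqp)) (sub_nonneg.2 h_two)
    have h3 := mul_nonneg (sq_nonneg q) (sub_nonneg.2 h_three)
    have h4 := mul_nonneg (mul_nonneg hp.le hq) (sub_nonneg.2 h_top)
    linarith
  have h_amgm : p * q * (2 * √(b * e)) ≤ p ^ 2 * e + q ^ 2 * b := by
    have h := two_mul_le_add_sq (p * √e) (q * √b)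
    rw [mul_pow, mul_pow, Real.sq_sqrt he.le, Real.sq_sqrt hb] at h
    rw [Real.sqrt_mul hb]
    linarith
  rcases hq.eq_or_lt with rfl | hq
  · have := mul_pos (pow_pos hp 2) he
    linarith
  · have := mul_lt_mul_of_pos_left hl (mul_pos hp hq)
    linarith

lemma partialTransposeForm_pos (hT : EigenvalueBounds T l b c e) (hb : 0 ≤ b) (he : 0 < e)
    (hl : l < c + 2 * √(b * e)) {f : Fin 2 × Fin 2 → H} (hf : Orthonormal ℂ f)
    {m : Matrix (Fin 2) (Fin 2) ℝ} (hm : m ≠ 0) : 0 < partialTransposeForm T f m := by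
  obtain ⟨R, S, p, q, hR, hS, hq, hqp, rfl⟩ := exists_svd_fin_two m
  have hp : 0 < p := by
    refine (hq.trans hqp).lt_of_ne' fun hp => hm ?_
    have hq0 : q = 0 := by linarith
    have hD : Matrix.diagonal ![p, q] = 0 := by simp [hp, hq0]
    rw [hD, Matrix.mul_zero, Matrix.zero_mul]
  have hRS : (R ⊗ₖ S) * (R ⊗ₖ S)ᵀ = 1 := by
    rw [← Matrix.kroneckerMap_transpose, ← Matrix.mul_kronecker_mul, hR, hS,
      Matrix.one_kronecker_one]
  rw [partialTransposeForm_transpose_mul_mul, partialTransposeForm_diagonal]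
  exact hT.weighted_sum_pos hb he hl hp hq hqp
    (orthonormal_bellFrame (orthonormal_sum_smul hf hRS))

end EigenvalueBounds

end PartialTransposeForm

section MatchingAngles

variable {E H : Type*} [NormedAddCommGroup E] [InnerProductSpace ℂ E] [NormedAddCommGroup H]
  [InnerProductSpace ℂ H] {T : H →L[ℂ] H} {l b c e : ℝ} {Φ Ψ : E →ₗᵢ[ℂ] H}

lemma orthonormal_uncurry_of_inner_eq_zero (hΦΨ : ∀ x y, inner ℂ (Φ x) (Ψ y) = 0)
    {u u' : Fin 2 → E} (hu : Orthonormal ℂ u) (hu' : Orthonormal ℂ u') :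
    Orthonormal ℂ fun a : Fin 2 × Fin 2 => ![Φ ∘ u, Ψ ∘ u'] a.1 a.2 := by
  have hΨΦ x y : inner ℂ (Ψ x) (Φ y) = 0 := by rw [← inner_conj_symm, hΦΨ, map_zero]
  refine ⟨fun ⟨i, j⟩ => ?_, fun ⟨i, j⟩ ⟨i', j'⟩ hij => ?_⟩
  · fin_cases i <;> simp [hu.1, hu'.1]
  · rw [Ne, Prod.mk.injEq, not_and] at hij
    fin_cases i <;> fin_cases i' <;> simp_all [hu.inner_eq_zero, hu'.inner_eq_zero]

namespace EigenvalueBounds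

lemma two_mul_re_inner_lt (hT : EigenvalueBounds T l b c e) (hb : 0 ≤ b) (he : 0 < e)
    (hl : l < c + 2 * √(b * e)) (hΦΨ : ∀ x y, inner ℂ (Φ x) (Ψ y) = 0) {v v' y y' x w : E}
    (hv : Orthonormal ℂ ![v, v']) (hy : Orthonormal ℂ ![y, y']) {γ σ : ℝ}
    (hx : x = (γ : ℂ) • v + (σ : ℂ) • v') (hw : w = (γ : ℂ) • y + (σ : ℂ) • y') {s t : ℝ}
    (hs : s ≠ 0) :
    2 * s * t * (inner ℂ (Φ x) (T (Ψ y))).re <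
      s ^ 2 * T.reApplyInnerSelf (Φ v) + t ^ 2 * T.reApplyInnerSelf (Ψ w) := by
  have hm : !![s, 0; -(t * γ), -(t * σ)] ≠ 0 := fun h => hs (by simpa using congrFun₂ h 0 0)
  have h_pos := hT.partialTransposeForm_pos hb he hl
    (orthonormal_uncurry_of_inner_eq_zero hΦΨ hv hy) hm
  have h_symm z : (inner ℂ (T (Ψ y)) (Φ z)).re = (inner ℂ (T (Φ z)) (Ψ y)).re := by
    rw [← inner_conj_symm, Complex.conj_re]; exact congrArg _ (hT.isSymmetric _ _).symm
  have h_symm' z : (inner ℂ (Φ z) (T (Ψ y))).re = (inner ℂ (T (Φ z)) (Ψ y)).re :=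
    congrArg _ (hT.isSymmetric _ _).symm
  subst hx hw
  rw [h_symm']
  refine sub_pos.1 (h_pos.trans_eq ?_)
  simp [partialTransposeForm, Fin.sum_univ_two, ContinuousLinearMap.reApplyInnerSelf,
    inner_add_left, inner_add_right, inner_smul_left, inner_smul_right, h_symm, -Complex.coe_smul]
  ring

lemma re_inner_lt_sqrt_of_inner_eq (hT : EigenvalueBounds T l b c e) (hb : 0 ≤ b) (he : 0 < e)
    (hl : l < c + 2 * √(b * e)) (hE : 1 < Module.finrank ℂ E)
    (hΦΨ : ∀ x y, inner ℂ (Φ x) (Ψ y) = 0) {v w x y : E} (hv : ‖v‖ = 1) (hw : ‖w‖ = 1)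
    (hx : ‖x‖ = 1) (hy : ‖y‖ = 1) {γ : ℝ} (hvx : inner ℂ v x = γ) (hyw : inner ℂ y w = γ) :
    (inner ℂ (Φ x) (T (Ψ y))).re < √(T.reApplyInnerSelf (Φ v) * T.reApplyInnerSelf (Ψ w)) := by
  obtain ⟨v', hv', hxv⟩ := exists_orthonormal_pair_of_inner_eq hE hv hx hvx
  obtain ⟨y', hy', hwy⟩ := exists_orthonormal_pair_of_inner_eq hE hy hw hyw
  have hA : 0 < T.reApplyInnerSelf (Φ v) := he.trans_le (hT.le_one _ (by rw [Φ.norm_map, hv]))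
  have hC : 0 < T.reApplyInnerSelf (Ψ w) := he.trans_le (hT.le_one _ (by rw [Ψ.norm_map, hw]))
  have hAC : 0 < √(T.reApplyInnerSelf (Φ v) * T.reApplyInnerSelf (Ψ w)) :=
    Real.sqrt_pos.2 (mul_pos hA hC)
  have h := hT.two_mul_re_inner_lt hb he hl hΦΨ hv' hy' hxv hwy
    (s := √(T.reApplyInnerSelf (Ψ w))) (t := √(T.reApplyInnerSelf (Φ v)))
    (Real.sqrt_pos.2 hC).ne'
  rw [Real.sq_sqrt hA.le, Real.sq_sqrt hC.le, mul_assoc 2, mul_comm (√_) (√_),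
    ← Real.sqrt_mul hA.le] at h
  refine lt_of_mul_lt_mul_left ?_ hAC.le
  rw [Real.mul_self_sqrt (mul_pos hA hC).le]
  linarith

lemma re_inner_lt_sqrt (hT : EigenvalueBounds T l b c e) (hb : 0 ≤ b) (he : 0 < e)
    (hl : l < c + 2 * √(b * e)) (hE : 1 < Module.finrank ℂ E)
    (hΦΨ : ∀ x y, inner ℂ (Φ x) (Ψ y) = 0) {v w x y : E} (hv : ‖v‖ = 1) (hw : ‖w‖ = 1)
    (hx : ‖x‖ = 1) (hy : ‖y‖ = 1) (h : ‖inner ℂ v x‖ = ‖inner ℂ w y‖) :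
    (inner ℂ (Φ x) (T (Ψ y))).re < √(T.reApplyInnerSelf (Φ v) * T.reApplyInnerSelf (Ψ w)) := by
  obtain ⟨η, hη, hvx⟩ := Complex.exists_norm_eq_mul_self (inner ℂ v x)
  obtain ⟨ζ, hζ, hyw⟩ := Complex.exists_norm_eq_mul_self (inner ℂ y w)
  have h_phase (f : E →ₗᵢ[ℂ] H) {ω : ℂ} (hω : ‖ω‖ = 1) z :
      T.reApplyInnerSelf (f (ω • z)) = T.reApplyInnerSelf (f z) := by
    rw [map_smul, T.reApplyInnerSelf_smul, hω, one_pow, one_mul]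
  rw [← h_phase Φ (ω := star η) (by rwa [norm_star]) v, ← h_phase Ψ hζ w]
  refine hT.re_inner_lt_sqrt_of_inner_eq hb he hl hE hΦΨ (γ := ‖inner ℂ v x‖) ?_ ?_ hx hy ?_ ?_
  · rw [norm_smul, norm_star, hη, hv, one_mul]
  · rw [norm_smul, hζ, hw, one_mul]
  · rw [inner_smul_left, Complex.star_def, Complex.conj_conj, ← hvx]
  · rw [inner_smul_right, ← hyw, h, norm_inner_symm]

end EigenvalueBounds

end MatchingAngles

section ConnectedFibers

variable {X Y : Type*} [TopologicalSpace X] [TopologicalSpace Y] [T2Space X] [ConnectedSpace X]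

lemma isConnected_of_isConnected_fibers {K : Set (X × Y)} (hK : IsCompact K)
    (hfib : ∀ x, IsConnected {y | (x, y) ∈ K}) : IsConnected K := by
  have : CompactSpace K := isCompact_iff_compactSpace.1 hK
  let π : K → X := fun p => p.1.1
  have hπ : Continuous π := continuous_fst.comp continuous_subtype_val
  have hπ_fib x : IsConnected (π ⁻¹' {x}) := by
    have : ConnectedSpace {y | (x, y) ∈ K} := isConnected_iff_connectedSpace.1 (hfib x)
    convert isConnected_range (f := fun y : {y | (x, y) ∈ K} => (⟨(x, y), y.2⟩ : K)) (by fun_prop)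
    ext ⟨⟨x', y⟩, h⟩
    aesop
  have hπ_quot : Topology.IsQuotientMap π :=
    hπ.isClosedMap.isQuotientMap hπ fun x => (hπ_fib x).nonempty
  rw [isConnected_iff_connectedSpace, connectedSpace_iff_univ]
  exact hπ_quot.isCoinducing.isConnected_preimage_of_isClosed hπ_fib isClosed_univ isConnected_univ

end ConnectedFibers

section TopVectors

variable {E : Type*} [NormedAddCommGroup E]

lemma isConnected_setOf_norm_eq_one_and_mem [NormedSpace ℂ E] [FiniteDimensional ℂ E]
    {F : Submodule ℂ E} (hF : F ≠ ⊥) : IsConnected {v : E | ‖v‖ = 1 ∧ v ∈ F} := by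
  have : Nontrivial F := Submodule.nontrivial_iff_ne_bot.2 hF
  have h_rank : 1 < Module.rank ℝ F := Module.lt_rank_of_lt_finrank <| by
    have h_pos : 0 < Module.finrank ℂ F := Module.finrank_pos
    rw [finrank_real_of_complex]
    lia
  convert (isConnected_sphere h_rank 0 zero_le_one).image _ continuous_subtype_val.continuousOn
  ext v
  simp [and_comm]

variable [InnerProductSpace ℂ E]

/-- The unit eigenvectors of `P` with eigenvalue `‖P‖`. -/
def topEigenvectors (P : E →L[ℂ] E) : Set E := {v | ‖v‖ = 1 ∧ P v = (‖P‖ : ℂ) • v}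

lemma isClosed_setOf_mem_topEigenvectors {X : Type*} [TopologicalSpace X] {P : X → E →L[ℂ] E}
    (hP : Continuous P) : IsClosed {p : X × E | p.2 ∈ topEigenvectors (P p.1)} :=
  (isClosed_eq (by fun_prop) (by fun_prop)).inter (isClosed_eq (by fun_prop) (by fun_prop))

variable [FiniteDimensional ℂ E]

lemma eigenspace_opNorm_ne_bot [Nontrivial E] {P : E →L[ℂ] E}
    (hP : P.IsPositive) : Module.End.eigenspace (P : E →ₗ[ℂ] E) (‖P‖ : ℂ) ≠ ⊥ := by
  have : CompleteSpace E := FiniteDimensional.complete ℂ E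
  have h_spec : ‖P‖ ∈ spectrum ℝ P := CStarAlgebra.norm_mem_spectrum_of_nonneg
    (P.nonneg_iff_isPositive.2 hP)
  rw [← spectrum.algebraMap_mem_iff ℂ, ContinuousLinearMap.spectrum_eq] at h_spec
  exact Module.End.hasEigenvalue_iff_mem_spectrum.2 h_spec

lemma isConnected_topEigenvectors [Nontrivial E] {P : E →L[ℂ] E} (hP : P.IsPositive) :
    IsConnected (topEigenvectors P) := by
  convert isConnected_setOf_norm_eq_one_and_mem (eigenspace_opNorm_ne_bot hP)
    using 1
  ext v
  simp [topEigenvectors]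

end TopVectors

section SingularPairs

open ContinuousLinearMap (adjoint)

variable {E : Type*} [NormedAddCommGroup E] [InnerProductSpace ℂ E] [CompleteSpace E]
  {B : E →L[ℂ] E}

/-- The pairs `(x, y)` of left and right singular vectors of `B` for the singular value `‖B‖`,
normalized in the sup norm of the product: if `B ≠ 0` then `x` and `y` are unit vectors, and if
`B = 0` then `(x, y)` is an arbitrary unit vector. -/
def topSingularPairs (B : E →L[ℂ] E) : Set (E × E) :=
  {p | ‖p‖ = 1 ∧ B p.2 = (‖B‖ : ℂ) • p.1 ∧ adjoint B p.1 = (‖B‖ : ℂ) • p.2}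

lemma norm_fst_eq_norm_snd_of_mem_topSingularPairs (hB : B ≠ 0) {p : E × E}
    (hp : p ∈ topSingularPairs B) : ‖p.1‖ = ‖p.2‖ := by
  have hB' : 0 < ‖B‖ := norm_pos_iff.2 hB
  have h₁ := B.le_opNorm p.2
  have h₂ := (adjoint B).le_opNorm p.1
  rw [hp.2.1, norm_smul, Complex.norm_real, norm_norm] at h₁
  rw [hp.2.2, norm_smul, Complex.norm_real, norm_norm, LinearIsometryEquiv.norm_map] at h₂
  exact le_antisymm (le_of_mul_le_mul_left h₁ hB') (le_of_mul_le_mul_left h₂ hB')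

lemma norm_fst_of_mem_topSingularPairs (hB : B ≠ 0) {p : E × E} (hp : p ∈ topSingularPairs B) :
    ‖p.1‖ = 1 := by
  rw [← hp.1, Prod.norm_def, norm_fst_eq_norm_snd_of_mem_topSingularPairs hB hp, max_self]

lemma norm_snd_of_mem_topSingularPairs (hB : B ≠ 0) {p : E × E} (hp : p ∈ topSingularPairs B) :
    ‖p.2‖ = 1 := by
  rw [← norm_fst_eq_norm_snd_of_mem_topSingularPairs hB hp,
    norm_fst_of_mem_topSingularPairs hB hp]

lemma re_inner_apply_of_mem_topSingularPairs (hB : B ≠ 0) {p : E × E}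
    (hp : p ∈ topSingularPairs B) : (inner ℂ p.1 (B p.2)).re = ‖B‖ := by
  rw [hp.2.1, inner_smul_right, inner_self_eq_norm_sq_to_K, norm_fst_of_mem_topSingularPairs hB hp]
  simp

lemma swap_neg_mem_topSingularPairs {p : E × E} (hp : p ∈ topSingularPairs B) :
    (p.2, -p.1) ∈ topSingularPairs (-adjoint B) := by
  refine ⟨?_, ?_, ?_⟩
  · rw [Prod.norm_mk, norm_neg, max_comm]
    exact hp.1
  · simp [hp.2.2]
  · simp [hp.2.1]

lemma isClosed_setOf_mem_topSingularPairs {X : Type*} [TopologicalSpace X] {B : X → E →L[ℂ] E}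
    (hB : Continuous B) : IsClosed {p : X × E × E | p.2 ∈ topSingularPairs (B p.1)} := by
  have : Continuous fun x => adjoint (B x) := adjoint.continuous.comp hB
  exact (isClosed_eq (by fun_prop) (by fun_prop)).inter
    ((isClosed_eq (by fun_prop) (by fun_prop)).inter (isClosed_eq (by fun_prop) (by fun_prop)))

variable [FiniteDimensional ℂ E] [Nontrivial E]

lemma exists_mem_topSingularPairs_of_ne_zero (hB : B ≠ 0) : ∃ p, p ∈ topSingularPairs B := by
  have hB' : (‖B‖ : ℂ) ≠ 0 := by simpa using hB
  obtain ⟨y, hy, hBy⟩ := (isConnected_topEigenvectors B.isPositive_adjoint_comp_self).nonempty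
  rw [ContinuousLinearMap.norm_adjoint_comp_self, ContinuousLinearMap.comp_apply] at hBy
  have hx : ‖(‖B‖ : ℂ)⁻¹ • B y‖ ≤ 1 := by
    rw [norm_smul, norm_inv, Complex.norm_real, norm_norm, inv_mul_le_iff₀ (norm_pos_iff.2 hB)]
    simpa [hy] using B.le_opNorm y
  refine ⟨((‖B‖ : ℂ)⁻¹ • B y, y), ?_, ?_, ?_⟩
  · rw [Prod.norm_mk, hy, max_eq_right hx]
  · rw [smul_inv_smul₀ hB']
  · rw [map_smul, hBy, Complex.ofReal_mul, mul_smul, inv_smul_smul₀ hB']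

lemma isConnected_topSingularPairs (B : E →L[ℂ] E) : IsConnected (topSingularPairs B) := by
  let F : Submodule ℂ (E × E) :=
    LinearMap.ker ((B : E →ₗ[ℂ] E) ∘ₗ .snd ℂ E E - (‖B‖ : ℂ) • .fst ℂ E E) ⊓
      LinearMap.ker ((adjoint B : E →ₗ[ℂ] E) ∘ₗ .fst ℂ E E - (‖B‖ : ℂ) • .snd ℂ E E)
  have hF p : p ∈ F ↔ B p.2 = (‖B‖ : ℂ) • p.1 ∧ adjoint B p.1 = (‖B‖ : ℂ) • p.2 := by
    simp [F, sub_eq_zero]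
  have hF_ne : F ≠ ⊥ := by
    rw [Submodule.ne_bot_iff]
    by_cases hB : B = 0
    · obtain ⟨p, hp⟩ := exists_ne (0 : E × E)
      exact ⟨p, by simp [hF, hB], hp⟩
    · obtain ⟨p, hp⟩ := exists_mem_topSingularPairs_of_ne_zero hB
      exact ⟨p, (hF p).2 hp.2, norm_ne_zero_iff.1 (hp.1.trans_ne one_ne_zero)⟩
  have h_eq : topSingularPairs B = {p | ‖p‖ = 1 ∧ p ∈ F} :=
    Set.ext fun p => and_congr_right fun _ => (hF p).symm
  rw [h_eq]
  exact isConnected_setOf_norm_eq_one_and_mem hF_ne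

end SingularPairs

section Matching

open ContinuousLinearMap (adjoint)

variable {X E : Type*} [TopologicalSpace X] [T2Space X] [CompactSpace X] [ConnectedSpace X]
  [NormedAddCommGroup E] [InnerProductSpace ℂ E] [FiniteDimensional ℂ E] [CompleteSpace E]
  [Nontrivial E] {P P' B : X → E →L[ℂ] E}

lemma isConnected_setOf_topVectors (hP : Continuous P) (hP' : Continuous P') (hB : Continuous B)
    (hP_pos : ∀ s, (P s).IsPositive) (hP'_pos : ∀ s, (P' s).IsPositive) :
    IsConnected {p : X × E × E × E × E | p.2.1 ∈ topEigenvectors (P p.1) ∧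
      p.2.2.1 ∈ topEigenvectors (P' p.1) ∧ p.2.2.2 ∈ topSingularPairs (B p.1)} := by
  refine isConnected_of_isConnected_fibers ?_ fun s =>
    (isConnected_topEigenvectors (hP_pos s)).prod
      ((isConnected_topEigenvectors (hP'_pos s)).prod (isConnected_topSingularPairs (B s)))
  refine .of_isClosed_subset (isCompact_univ.prod ((isCompact_sphere 0 1).prod
    ((isCompact_sphere 0 1).prod (isCompact_sphere 0 1)))) ?_ fun p ⟨hv, hw, hxy⟩ =>
      ⟨trivial, by simpa using hv.1, by simpa using hw.1, by simpa using hxy.1⟩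
  exact ((isClosed_setOf_mem_topEigenvectors hP).preimage
      (f := fun p : X × E × E × E × E => (p.1, p.2.1)) (by fun_prop)).inter
    (((isClosed_setOf_mem_topEigenvectors hP').preimage
      (f := fun p : X × E × E × E × E => (p.1, p.2.2.1)) (by fun_prop)).inter
    ((isClosed_setOf_mem_topSingularPairs hB).preimage
      (f := fun p : X × E × E × E × E => (p.1, p.2.2.2)) (by fun_prop)))

/- Exchanging the roles of `P` and `P'` and of the two singular vectors reverses the sign of
`‖⟪v, x⟫‖ - ‖⟪w, y⟫‖`, so this function vanishes somewhere on the connected set of all choices. -/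
lemma exists_topVectors_norm_inner_eq (hP : Continuous P) (hP' : Continuous P')
    (hB : Continuous B) (hP_pos : ∀ s, (P s).IsPositive) (hP'_pos : ∀ s, (P' s).IsPositive)
    {s₀ s₁ : X} (hP₁ : P s₁ = P' s₀) (hP'₁ : P' s₁ = P s₀) (hB₁ : B s₁ = -adjoint (B s₀)) :
    ∃ s, ∃ v ∈ topEigenvectors (P s), ∃ w ∈ topEigenvectors (P' s),
      ∃ p ∈ topSingularPairs (B s), ‖inner ℂ v p.1‖ = ‖inner ℂ w p.2‖ := by
  let f : X × E × E × E × E → ℝ := fun p =>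
    ‖inner ℂ p.2.1 p.2.2.2.1‖ - ‖inner ℂ p.2.2.1 p.2.2.2.2‖
  have hf : Continuous f := by fun_prop
  obtain ⟨v, hv⟩ := (isConnected_topEigenvectors (hP_pos s₀)).nonempty
  obtain ⟨w, hw⟩ := (isConnected_topEigenvectors (hP'_pos s₀)).nonempty
  obtain ⟨p, hp⟩ := (isConnected_topSingularPairs (B s₀)).nonempty
  have h_swap : f (s₁, w, v, p.2, -p.1) = -f (s₀, v, w, p) := by simp [f]
  obtain ⟨⟨s, v, w, p⟩, ⟨hv, hw, hp⟩, h_zero⟩ : (0 : ℝ) ∈ f '' _ :=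
    ((isConnected_setOf_topVectors hP hP' hB hP_pos hP'_pos).image f
      hf.continuousOn).isPreconnected.ordConnected.uIcc_subset
      ⟨(s₀, v, w, p), ⟨hv, hw, hp⟩, rfl⟩
      ⟨(s₁, w, v, p.2, -p.1), ⟨by rwa [hP₁], by rwa [hP'₁],
        by rw [hB₁]; exact swap_neg_mem_topSingularPairs hp⟩, h_swap⟩
      (by rw [Set.mem_uIcc]; rcases le_total 0 (f (s₀, v, w, p)) with h | h <;> simp [h])
  exact ⟨s, v, hv, w, hw, p, hp, sub_eq_zero.1 h_zero⟩

end Matching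

section SeparableCone

open Matrix

variable {m n m' n' : Type*}

/-- The cone of unnormalized separable operators: finite sums of Kronecker products of positive
semidefinite matrices. -/
def separableCone (m n : Type*) : AddSubmonoid (Matrix (m × n) (m × n) ℂ) :=
  .closure {M | ∃ (P : Matrix m m ℂ) (Q : Matrix n n ℂ), P.PosSemidef ∧ Q.PosSemidef ∧ M = P ⊗ₖ Q}

lemma kronecker_mem_separableCone {P : Matrix m m ℂ} {Q : Matrix n n ℂ} (hP : P.PosSemidef)
    (hQ : Q.PosSemidef) : P ⊗ₖ Q ∈ separableCone m n :=
  AddSubmonoid.subset_closure ⟨P, Q, hP, hQ, rfl⟩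

variable [Fintype m] [Fintype n]

lemma conjTranspose_kronecker_mul_mul_mem_separableCone [Finite m'] [Finite n']
    (F : Matrix m m' ℂ) (G : Matrix n n' ℂ) {M : Matrix (m × n) (m × n) ℂ}
    (hM : M ∈ separableCone m n) : (F ⊗ₖ G)ᴴ * M * (F ⊗ₖ G) ∈ separableCone m' n' := by
  induction hM using AddSubmonoid.closure_induction with
  | mem M hM =>
    obtain ⟨P, Q, hP, hQ, rfl⟩ := hM
    rw [conjTranspose_kronecker, ← mul_kronecker_mul, ← mul_kronecker_mul]
    exact kronecker_mem_separableCone (hP.conjTranspose_mul_mul_same F)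
      (hQ.conjTranspose_mul_mul_same G)
  | zero => simp
  | add M N _ _ hM hN =>
    rw [Matrix.mul_add, Matrix.add_mul]
    exact add_mem hM hN

lemma conjTranspose_kronecker_mul_mul_mem_separableCone_iff [DecidableEq m] [DecidableEq n]
    {F : Matrix m m ℂ} {G : Matrix n n ℂ} (hF : IsUnit F) (hG : IsUnit G)
    {M : Matrix (m × n) (m × n) ℂ} :
    (F ⊗ₖ G)ᴴ * M * (F ⊗ₖ G) ∈ separableCone m n ↔ M ∈ separableCone m n := by
  refine ⟨fun h => ?_, conjTranspose_kronecker_mul_mul_mem_separableCone F G⟩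
  have h_inv : F ⊗ₖ G * F⁻¹ ⊗ₖ G⁻¹ = 1 := by
    rw [← mul_kronecker_mul, mul_nonsing_inv _ ((isUnit_iff_isUnit_det F).1 hF),
      mul_nonsing_inv _ ((isUnit_iff_isUnit_det G).1 hG), one_kronecker_one]
  convert conjTranspose_kronecker_mul_mul_mem_separableCone F⁻¹ G⁻¹ h using 1
  rw [Matrix.mul_assoc, Matrix.mul_assoc, Matrix.mul_assoc, h_inv, Matrix.mul_one,
    ← Matrix.mul_assoc, ← conjTranspose_mul, h_inv, conjTranspose_one, Matrix.one_mul]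

end SeparableCone

section Blocks

open Matrix

variable {n : Type*}

/-- The operator on `ℂ² ⊗ ℂⁿ` with the given `n × n` blocks. -/
def blockMatrix (A B C D : Matrix n n ℂ) : Matrix (Fin 2 × n) (Fin 2 × n) ℂ :=
  Matrix.comp _ _ _ _ _ !![A, B; C, D]

lemma comp_symm_blockMatrix (A B C D : Matrix n n ℂ) :
    (Matrix.comp _ _ _ _ _).symm (blockMatrix A B C D) = !![A, B; C, D] :=
  Equiv.symm_apply_apply _ _

lemma blockMatrix_add (A B C D A' B' C' D' : Matrix n n ℂ) :
    blockMatrix A B C D + blockMatrix A' B' C' D' =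
      blockMatrix (A + A') (B + B') (C + C') (D + D') := by
  ext ⟨i, x⟩ ⟨j, y⟩
  fin_cases i <;> fin_cases j <;> rfl

lemma comp_symm_conjTranspose_kronecker_mul_mul {m m' n' : Type*} [Fintype m] [Fintype n]
    (F : Matrix m m' ℂ) (G : Matrix n n' ℂ) (M : Matrix (m × n) (m × n) ℂ) (i j : m') :
    (Matrix.comp _ _ _ _ _).symm ((F ⊗ₖ G)ᴴ * M * (F ⊗ₖ G)) i j =
      ∑ k, ∑ l, (star (F k i) * F l j) • (Gᴴ * (Matrix.comp _ _ _ _ _).symm M k l * G) := by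
  ext x y
  simp only [Matrix.comp_symm_apply, Matrix.mul_apply, Fintype.sum_prod_type, Matrix.sum_apply,
    Matrix.conjTranspose_apply, Matrix.kroneckerMap_apply, Matrix.smul_apply, smul_eq_mul,
    star_mul', Finset.sum_mul, Finset.mul_sum]
  refine Eq.trans (Finset.sum_congr rfl fun l _ => Finset.sum_comm) (Finset.sum_comm.trans ?_)
  refine Finset.sum_congr rfl fun k _ => Finset.sum_congr rfl fun l _ =>
    Finset.sum_congr rfl fun b _ => Finset.sum_congr rfl fun a _ => ?_
  ring

lemma blockMatrix_zero_mem_separableCone {A D : Matrix n n ℂ} (hA : A.PosSemidef)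
    (hD : D.PosSemidef) : blockMatrix A 0 0 D ∈ separableCone (Fin 2) n := by
  have h_eq : blockMatrix A 0 0 D = diagonal ![1, 0] ⊗ₖ A + diagonal ![0, 1] ⊗ₖ D := by
    ext ⟨i, x⟩ ⟨j, y⟩
    fin_cases i <;> fin_cases j <;> simp [blockMatrix]
  rw [h_eq]
  exact add_mem (kronecker_mem_separableCone (by simp [posSemidef_diagonal_iff]) hA)
    (kronecker_mem_separableCone (by simp [posSemidef_diagonal_iff]) hD)

lemma eq_blockMatrix_iff {A B C D : Matrix n n ℂ} {M : Matrix (Fin 2 × n) (Fin 2 × n) ℂ} :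
    M = blockMatrix A B C D ↔
      (Matrix.comp _ _ _ _ _).symm M 0 0 = A ∧ (Matrix.comp _ _ _ _ _).symm M 0 1 = B ∧
        (Matrix.comp _ _ _ _ _).symm M 1 0 = C ∧ (Matrix.comp _ _ _ _ _).symm M 1 1 = D := by
  rw [blockMatrix, ← Equiv.symm_apply_eq, ← Matrix.ext_iff]
  simp [Fin.forall_fin_two, and_assoc]

lemma conjTranspose_comp_symm_of_isHermitian {m : Type*} {M : Matrix (m × n) (m × n) ℂ}
    (hM : M.IsHermitian) (i j : m) : ((Matrix.comp _ _ _ _ _).symm M i j)ᴴ =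
      (Matrix.comp _ _ _ _ _).symm M j i := by
  ext k a
  exact hM.apply _ _

lemma eq_blockMatrix_of_isHermitian {M : Matrix (Fin 2 × n) (Fin 2 × n) ℂ} (hM : M.IsHermitian) :
    M = blockMatrix ((Matrix.comp _ _ _ _ _).symm M 0 0) ((Matrix.comp _ _ _ _ _).symm M 0 1)
      ((Matrix.comp _ _ _ _ _).symm M 0 1)ᴴ ((Matrix.comp _ _ _ _ _).symm M 1 1) :=
  eq_blockMatrix_iff.2 ⟨rfl, rfl, (conjTranspose_comp_symm_of_isHermitian hM 0 1).symm, rfl⟩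

lemma posSemidef_blockMatrix_one_iff [Fintype n] [DecidableEq n] {X R : Matrix n n ℂ} :
    (blockMatrix 1 X Xᴴ R).PosSemidef ↔ (R - Xᴴ * X).PosSemidef := by
  let := invertibleOne (α := Matrix n n ℂ)
  let e : Fin 2 × n ≃ n ⊕ n :=
    (finTwoEquiv.prodCongr (Equiv.refl n)).trans (Equiv.boolProdEquivSum n)
  have h_eq : blockMatrix 1 X Xᴴ R = (fromBlocks 1 X Xᴴ R).submatrix e e := by
    ext ⟨i, x⟩ ⟨j, y⟩
    fin_cases i <;> fin_cases j <;> rfl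
  rw [h_eq, posSemidef_submatrix_equiv, PosDef.fromBlocks₁₁ X R PosDef.one, inv_one, Matrix.mul_one]

lemma blockMatrix_one_diagonal_mem_separableCone [Finite n] [DecidableEq n]
    {R : Matrix n n ℂ} {h : n → ℝ}
    (hR : (blockMatrix 1 (diagonal fun k => (h k : ℂ)) (diagonal fun k => (h k : ℂ))
      R).PosSemidef) :
    blockMatrix 1 (diagonal fun k => (h k : ℂ)) (diagonal fun k => (h k : ℂ)) R ∈
      separableCone (Fin 2) n := by
  cases nonempty_fintype n
  set D : Matrix n n ℂ := diagonal fun k => (h k : ℂ)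
  have hD_star : Dᴴ = D := by simp [D, Pi.star_def]
  have h_schur : (R - Dᴴ * D).PosSemidef := posSemidef_blockMatrix_one_iff.1 (by rwa [hD_star])
  have h_eq : blockMatrix 1 D D R = ∑ k, vecMulVec ![1, (h k : ℂ)] (star ![1, (h k : ℂ)]) ⊗ₖ
      diagonal (Pi.single k 1) + blockMatrix 0 0 0 (R - Dᴴ * D) := by
    ext ⟨i, x⟩ ⟨j, y⟩
    simp only [Matrix.add_apply, Matrix.sum_apply, kroneckerMap_apply, vecMulVec_apply]
    fin_cases i <;> fin_cases j <;>
      simp [blockMatrix, D, diagonal_apply, Pi.single_apply, Matrix.one_apply]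
  rw [h_eq]
  exact add_mem (sum_mem fun k _ => kronecker_mem_separableCone
      (posSemidef_vecMulVec_self_star _) (.diagonal (Pi.single_nonneg.2 zero_le_one)))
    (blockMatrix_zero_mem_separableCone .zero h_schur)

open scoped MatrixOrder in
lemma exists_isUnit_conjTranspose_mul_mul_eq_one_diagonal [Fintype n] [DecidableEq n]
    {P Q : Matrix n n ℂ} (hP : P.PosDef) (hQ : Q.IsHermitian) :
    ∃ (Z : Matrix n n ℂ) (h : n → ℝ), IsUnit Z ∧ Zᴴ * P * Z = 1 ∧
      Zᴴ * Q * Z = diagonal fun k => (h k : ℂ) := by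
  obtain ⟨L, hL, rfl⟩ :=
    CStarAlgebra.isStrictlyPositive_iff_eq_star_mul_self.1 hP.isStrictlyPositive
  have hL_det : IsUnit L.det := (isUnit_iff_isUnit_det L).1 hL
  have hQ' : (L⁻¹ᴴ * Q * L⁻¹).IsHermitian := isHermitian_conjTranspose_mul_mul _ hQ
  let U : Matrix n n ℂ := ↑hQ'.eigenvectorUnitary
  have hU : Uᴴ * U = 1 := Unitary.star_mul_self_of_mem hQ'.eigenvectorUnitary.2
  have hLL : L * L⁻¹ = 1 := mul_nonsing_inv L hL_det
  refine ⟨L⁻¹ * U, hQ'.eigenvalues, ?_, ?_, ?_⟩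
  · exact ((isUnit_nonsing_inv_iff).2 hL).mul (IsUnit.of_mul_eq_one_right _ hU)
  · calc (L⁻¹ * U)ᴴ * (star L * L) * (L⁻¹ * U) = Uᴴ * ((L * L⁻¹)ᴴ * (L * L⁻¹)) * U := by
          simp only [conjTranspose_mul, star_eq_conjTranspose, Matrix.mul_assoc]
      _ = 1 := by simp only [hLL, conjTranspose_one, Matrix.mul_one, hU]
  · have h_diag : Uᴴ * (L⁻¹ᴴ * Q * L⁻¹) * U = diagonal (RCLike.ofReal ∘ hQ'.eigenvalues) := by
      rw [← hQ'.conjStarAlgAut_star_eigenvectorUnitary, Unitary.conjStarAlgAut_star_apply]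
      rfl
    calc (L⁻¹ * U)ᴴ * Q * (L⁻¹ * U) = Uᴴ * (L⁻¹ᴴ * Q * L⁻¹) * U := by
          simp only [conjTranspose_mul, Matrix.mul_assoc]
      _ = _ := h_diag

lemma blockMatrix_mem_separableCone_of_isHermitian [Finite n] {P Q R : Matrix n n ℂ}
    (hP : P.PosDef) (hQ : Q.IsHermitian) (h : (blockMatrix P Q Q R).PosSemidef) :
    blockMatrix P Q Q R ∈ separableCone (Fin 2) n := by
  classical
  cases nonempty_fintype n
  obtain ⟨Z, d, hZ, hPZ, hQZ⟩ := exists_isUnit_conjTranspose_mul_mul_eq_one_diagonal hP hQ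
  have h_conj : ((1 : Matrix (Fin 2) (Fin 2) ℂ) ⊗ₖ Z)ᴴ * blockMatrix P Q Q R * (1 ⊗ₖ Z) =
      blockMatrix 1 (diagonal fun k => (d k : ℂ)) (diagonal fun k => (d k : ℂ)) (Zᴴ * R * Z) := by
    rw [eq_blockMatrix_iff]
    simp only [comp_symm_conjTranspose_kronecker_mul_mul, comp_symm_blockMatrix]
    simp [hPZ, hQZ]
  rw [← conjTranspose_kronecker_mul_mul_mem_separableCone_iff isUnit_one hZ, h_conj]
  refine blockMatrix_one_diagonal_mem_separableCone ?_
  rw [← h_conj]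
  exact h.conjTranspose_mul_mul_same _

variable [Fintype n] [DecidableEq n]

open scoped Matrix.Norms.L2Operator MatrixOrder in
/- The local filter `F ⊗ 1` makes the operator invariant under partial transposition. -/
lemma blockMatrix_one_mem_separableCone {X : Matrix n n ℂ} (hX : ‖X‖ < 1) :
    blockMatrix 1 X Xᴴ 1 ∈ separableCone (Fin 2) n := by
  have h_le : (1 - Xᴴ * X).PosSemidef := by
    rw [← Matrix.le_iff, ← star_eq_conjTranspose,
      ← CStarAlgebra.norm_le_one_iff_of_nonneg _ (star_mul_self_nonneg X),
      CStarRing.norm_star_mul_self]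
    exact mul_le_one₀ hX.le (norm_nonneg X) hX.le
  have h_pos : (2 + (X + Xᴴ)).PosDef := by
    have h_unit : IsUnit (1 + X) := by
      simpa using isUnit_one_sub_of_norm_lt_one (x := -X) (by rwa [norm_neg])
    convert (IsUnit.posDef_star_left_conjugate_iff h_unit).2 PosDef.one |>.add_posSemidef h_le
      using 1
    rw [star_add, star_one, star_eq_conjTranspose]
    rw [← one_add_one_eq_two]
    noncomm_ring
  let F : Matrix (Fin 2) (Fin 2) ℂ := !![1, Complex.I; 1, -Complex.I]
  have hF : IsUnit F := by
    rw [isUnit_iff_isUnit_det, isUnit_iff_ne_zero, det_fin_two_of, one_mul, mul_one]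
    norm_num [Complex.ext_iff]
  have h_conj : (F ⊗ₖ (1 : Matrix n n ℂ))ᴴ * blockMatrix 1 X Xᴴ 1 * (F ⊗ₖ 1) =
      blockMatrix (2 + (X + Xᴴ)) (Complex.I • (Xᴴ - X)) (Complex.I • (Xᴴ - X)) (2 - (X + Xᴴ)) := by
    rw [eq_blockMatrix_iff]
    simp only [comp_symm_conjTranspose_kronecker_mul_mul, comp_symm_blockMatrix]
    simp only [F, Fin.sum_univ_two, of_apply, cons_val', cons_val_zero, cons_val_one,
      cons_val_fin_one, ← one_add_one_eq_two (R := Matrix n n ℂ)]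
    simp only [conjTranspose_one, star_one, star_neg,
      Complex.star_def, Complex.conj_I, neg_neg, neg_mul, mul_neg, one_mul, mul_one,
      Complex.I_mul_I, one_smul]
    refine ⟨?_, ?_, ?_, ?_⟩ <;> module
  rw [← conjTranspose_kronecker_mul_mul_mem_separableCone_iff hF isUnit_one, h_conj]
  refine blockMatrix_mem_separableCone_of_isHermitian h_pos ?_ ?_
  · rw [IsHermitian, conjTranspose_smul, conjTranspose_sub, conjTranspose_conjTranspose,
      Complex.star_def, Complex.conj_I, neg_smul, ← smul_neg, neg_sub]
  · rw [← h_conj]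
    exact (posSemidef_blockMatrix_one_iff.2 h_le).conjTranspose_mul_mul_same _

open scoped Matrix.Norms.L2Operator in
lemma blockMatrix_smul_one_mem_separableCone {α β : ℝ} (hα : 0 < α) (hβ : 0 < β) {B : Matrix n n ℂ}
    (hB : ‖B‖ < √(α * β)) :
    blockMatrix ((α : ℂ) • 1) B Bᴴ ((β : ℂ) • 1) ∈ separableCone (Fin 2) n := by
  have hαβ : 0 < √(α * β) := Real.sqrt_pos.2 (mul_pos hα hβ)
  let X : Matrix n n ℂ := (√(α * β))⁻¹ • B
  have hX : ‖X‖ < 1 := by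
    rw [norm_smul, norm_inv, Real.norm_of_nonneg hαβ.le]
    exact (inv_mul_lt_one₀ hαβ).2 hB
  have hXB : ((√α : ℂ) * √β) • X = B := by
    rw [← Complex.ofReal_mul, ← Real.sqrt_mul hα.le, Complex.coe_smul, smul_inv_smul₀ hαβ.ne']
  have h_conj : ((diagonal ![(√α : ℂ), √β] : Matrix (Fin 2) (Fin 2) ℂ) ⊗ₖ (1 : Matrix n n ℂ))ᴴ *
      blockMatrix 1 X Xᴴ 1 * (diagonal ![(√α : ℂ), √β] ⊗ₖ 1) =
      blockMatrix ((α : ℂ) • 1) B Bᴴ ((β : ℂ) • 1) := by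
    rw [eq_blockMatrix_iff]
    simp only [comp_symm_conjTranspose_kronecker_mul_mul, comp_symm_blockMatrix]
    simp [Fin.sum_univ_two, ← hXB, ← Complex.ofReal_mul, Real.mul_self_sqrt, hα.le, hβ.le,
      mul_comm √β]
  rw [← h_conj]
  exact conjTranspose_kronecker_mul_mul_mem_separableCone _ _ (blockMatrix_one_mem_separableCone hX)

open scoped Matrix.Norms.L2Operator in
lemma blockMatrix_mem_separableCone {A B C : Matrix n n ℂ} {α β : ℝ} (hα : 0 < α) (hβ : 0 < β)
    (hA : (A - (α : ℂ) • 1).PosSemidef) (hC : (C - (β : ℂ) • 1).PosSemidef)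
    (hB : ‖B‖ < √(α * β)) : blockMatrix A B Bᴴ C ∈ separableCone (Fin 2) n := by
  have h := add_mem (blockMatrix_zero_mem_separableCone hA hC)
    (blockMatrix_smul_one_mem_separableCone hα hβ hB)
  rwa [blockMatrix_add, sub_add_cancel, sub_add_cancel, zero_add, zero_add] at h

end Blocks

section BlockEmbedding

variable {m n : Type*} [Fintype m] [Fintype n] [DecidableEq m]

/-- The isometric embedding `x ↦ eᵢ ⊗ x` of `ℂⁿ` into `ℂᵐ ⊗ ℂⁿ`. -/
noncomputable def blockEmbedding (n : Type*) [Fintype n] (i : m) :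
    EuclideanSpace ℂ n →ₗᵢ[ℂ] EuclideanSpace ℂ (m × n) where
  toFun x := WithLp.toLp 2 (Function.uncurry (Pi.single i x.ofLp))
  map_add' x y := by ext ⟨j, k⟩; simp [Pi.single_add]
  map_smul' r x := by ext ⟨j, k⟩; simp [Pi.single_smul]
  norm_map' x := by
    simp only [EuclideanSpace.norm_eq, Fintype.sum_prod_type, LinearMap.coe_mk, AddHom.coe_mk,
      Function.uncurry_apply_pair]
    rw [Finset.sum_eq_single_of_mem i (Finset.mem_univ i) fun j _ hj => by simp [hj],
      Pi.single_eq_same]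

lemma blockEmbedding_apply (i : m) (x : EuclideanSpace ℂ n) (j : m) (a : n) :
    blockEmbedding n i x (j, a) = Pi.single (M := fun _ => n → ℂ) i x.ofLp j a := rfl

lemma inner_blockEmbedding_of_ne {i j : m} (hij : i ≠ j) (x y : EuclideanSpace ℂ n) :
    inner ℂ (blockEmbedding n i x) (blockEmbedding n j y) = 0 := by
  rw [PiLp.inner_apply]
  refine Finset.sum_eq_zero fun ⟨k, a⟩ _ => ?_
  obtain rfl | hk := eq_or_ne k i
  · simp [blockEmbedding_apply, hij]
  · simp [blockEmbedding_apply, hk]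

end BlockEmbedding

section RotatedBlocks

open Matrix

variable {m n : Type*} [Fintype m] [Fintype n] [DecidableEq n]

lemma continuous_toEuclideanCLM : Continuous (toEuclideanCLM (n := n) (𝕜 := ℂ)) :=
  LinearMap.continuous_of_finiteDimensional
    (toEuclideanCLM (n := n) (𝕜 := ℂ)).toAlgEquiv.toLinearMap

lemma isSymmetric_toEuclideanCLM_iff {M : Matrix n n ℂ} :
    (toEuclideanCLM (𝕜 := ℂ) M : EuclideanSpace ℂ n →ₗ[ℂ] EuclideanSpace ℂ n).IsSymmetric ↔
      M.IsHermitian :=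
  isSymmetric_toEuclideanLin_iff

namespace EigenvalueBounds

variable {l b c e : ℝ}

lemma unitary_conj {M U : Matrix n n ℂ} (hM : EigenvalueBounds (toEuclideanCLM (𝕜 := ℂ) M) l b c e)
    (hU : U ∈ unitaryGroup n ℂ) :
    EigenvalueBounds (toEuclideanCLM (𝕜 := ℂ) (Uᴴ * M * U)) l b c e := by
  let V := toEuclideanCLM (𝕜 := ℂ) U
  have hV : V ∈ unitary (EuclideanSpace ℂ n →L[ℂ] EuclideanSpace ℂ n) := Unitary.map_mem _ hU
  refine hM.of_isometry (Unitary.linearIsometryEquiv ⟨V, hV⟩).toLinearIsometry fun x y => ?_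
  rw [← star_eq_conjTranspose, map_mul, map_mul, map_star]
  exact ContinuousLinearMap.adjoint_inner_left V _ _

lemma isHermitian {M : Matrix n n ℂ}
    (hM : EigenvalueBounds (toEuclideanCLM (𝕜 := ℂ) M) l b c e) : M.IsHermitian :=
  isSymmetric_toEuclideanCLM_iff.1 hM.isSymmetric

lemma isPositive_smul_one_sub {H : Type*} [NormedAddCommGroup H] [InnerProductSpace ℂ H]
    [Nontrivial H] {T : H →L[ℂ] H} (hT : EigenvalueBounds T l b c e) :
    ((l : ℂ) • 1 - T).IsPositive := by
  refine ContinuousLinearMap.isPositive_def.2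
    ⟨(LinearMap.IsSymmetric.one.smul (Complex.conj_ofReal l)).sub hT.isSymmetric, fun x => ?_⟩
  obtain ⟨u, hu, hxu⟩ := exists_norm_eq_one_smul_eq x
  rw [hxu, ContinuousLinearMap.reApplyInnerSelf_smul]
  refine mul_nonneg (sq_nonneg _) ?_
  have h_le := hT.le_top u hu
  simpa [ContinuousLinearMap.reApplyInnerSelf, inner_sub_left, hu] using h_le

end EigenvalueBounds

lemma inner_blockEmbedding_toEuclideanCLM [DecidableEq m] (M : Matrix (m × n) (m × n) ℂ) (i j : m)
    (x y : EuclideanSpace ℂ n) :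
    inner ℂ (blockEmbedding n i x) (toEuclideanCLM (𝕜 := ℂ) M (blockEmbedding n j y)) =
      inner ℂ x (toEuclideanCLM (𝕜 := ℂ) ((Matrix.comp _ _ _ _ _).symm M i j) y) := by
  simp only [PiLp.inner_apply, ofLp_toEuclideanCLM, mulVec, dotProduct, Fintype.sum_prod_type,
    blockEmbedding_apply, Matrix.comp_symm_apply]
  rw [Finset.sum_eq_single_of_mem i (Finset.mem_univ i) fun k _ hk => by simp [hk]]
  refine Finset.sum_congr rfl fun a _ => ?_
  rw [Finset.sum_eq_single_of_mem j (Finset.mem_univ j) fun k _ hk => by simp [hk]]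
  simp only [Pi.single_eq_same]

lemma EigenvalueBounds.block [DecidableEq m] {M : Matrix (m × n) (m × n) ℂ} {l b c e : ℝ}
    (hM : EigenvalueBounds (toEuclideanCLM (𝕜 := ℂ) M) l b c e) (i : m) :
    EigenvalueBounds (toEuclideanCLM (𝕜 := ℂ) ((Matrix.comp _ _ _ _ _).symm M i i)) l b c e :=
  hM.of_isometry (blockEmbedding n i) fun x y => by
    rw [← inner_conj_symm, ← inner_blockEmbedding_toEuclideanCLM, inner_conj_symm]

open scoped Matrix.Norms.L2Operator MatrixOrder in
lemma posSemidef_sub_smul_one {A : Matrix n n ℂ} (hA : A.IsHermitian) (l : ℝ) :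
    (A - ((l - ‖(l : ℂ) • 1 - toEuclideanCLM (𝕜 := ℂ) A‖ : ℝ) : ℂ) • 1).PosSemidef := by
  have h_sa : IsSelfAdjoint ((l : ℂ) • 1 - A) :=
    (IsSelfAdjoint.smul (Complex.conj_ofReal l) (.one _)).sub hA
  have h_norm : ‖(l : ℂ) • 1 - toEuclideanCLM (𝕜 := ℂ) A‖ = ‖(l : ℂ) • 1 - A‖ := by
    rw [← l2_opNorm_toEuclideanCLM, map_sub, map_smul, map_one]
  have h_le := h_sa.le_algebraMap_norm_self
  rw [Matrix.le_iff, Algebra.algebraMap_eq_smul_one, ← Complex.coe_smul] at h_le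
  have h_eq : A - ((l - ‖(l : ℂ) • 1 - A‖ : ℝ) : ℂ) • 1 =
      ((‖(l : ℂ) • 1 - A‖ : ℝ) : ℂ) • 1 - ((l : ℂ) • 1 - A) := by
    push_cast
    module
  rwa [h_norm, h_eq]

end RotatedBlocks

section Separability

open Matrix

variable {n : Type*} [Fintype n] [DecidableEq n] {l b c e : ℝ}

lemma reApplyInnerSelf_of_mem_topEigenvectors {E : Type*} [NormedAddCommGroup E]
    [InnerProductSpace ℂ E] {T : E →L[ℂ] E} {v : E}
    (hv : v ∈ topEigenvectors ((l : ℂ) • 1 - T)) :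
    T.reApplyInnerSelf v = l - ‖(l : ℂ) • 1 - T‖ := by
  have h_apply : T v = ((l - ‖(l : ℂ) • 1 - T‖ : ℝ) : ℂ) • v := by
    rw [Complex.ofReal_sub, sub_smul, ← hv.2]
    simp
  simp [ContinuousLinearMap.reApplyInnerSelf, h_apply, inner_smul_left, hv.1]

lemma reApplyInnerSelf_blockEmbedding_of_mem_topEigenvectors {m : Type*} [Fintype m]
    [DecidableEq m] (M : Matrix (m × n) (m × n) ℂ) {i : m} {v : EuclideanSpace ℂ n}
    (hv : v ∈ topEigenvectors
      ((l : ℂ) • 1 - toEuclideanCLM (𝕜 := ℂ) ((Matrix.comp _ _ _ _ _).symm M i i))) :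
    (toEuclideanCLM (𝕜 := ℂ) M).reApplyInnerSelf (blockEmbedding n i v) =
      l - ‖(l : ℂ) • 1 - toEuclideanCLM (𝕜 := ℂ) ((Matrix.comp _ _ _ _ _).symm M i i)‖ := by
  rw [← reApplyInnerSelf_of_mem_topEigenvectors hv, ContinuousLinearMap.reApplyInnerSelf,
    ContinuousLinearMap.reApplyInnerSelf, inner_re_symm, inner_blockEmbedding_toEuclideanCLM,
    inner_re_symm]

/- The top eigenvectors of `l - A` and `l - C` attain the lower bounds for the diagonal blocks, and
the top singular pair attains the norm of the off-diagonal block. -/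
open scoped Matrix.Norms.L2Operator in
lemma blockMatrix_mem_separableCone_of_topVectors {A B C : Matrix n n ℂ}
    (hM : EigenvalueBounds (toEuclideanCLM (𝕜 := ℂ) (blockMatrix A B Bᴴ C)) l b c e)
    (hb : 0 ≤ b) (he : 0 < e) (hl : l < c + 2 * √(b * e)) (hn : 1 < Fintype.card n)
    {v w : EuclideanSpace ℂ n}
    {p : EuclideanSpace ℂ n × EuclideanSpace ℂ n}
    (hv : v ∈ topEigenvectors ((l : ℂ) • 1 - toEuclideanCLM (𝕜 := ℂ) A))
    (hw : w ∈ topEigenvectors ((l : ℂ) • 1 - toEuclideanCLM (𝕜 := ℂ) C))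
    (hp : p ∈ topSingularPairs (toEuclideanCLM (𝕜 := ℂ) B))
    (h : ‖inner ℂ v p.1‖ = ‖inner ℂ w p.2‖) :
    blockMatrix A B Bᴴ C ∈ separableCone (Fin 2) n := by
  set T := toEuclideanCLM (𝕜 := ℂ) (blockMatrix A B Bᴴ C)
  have h_pos (i : Fin 2) {u : EuclideanSpace ℂ n} (hu : ‖u‖ = 1) :
      0 < T.reApplyInnerSelf (blockEmbedding n i u) :=
    he.trans_le (hM.le_one _ (by rwa [LinearIsometry.norm_map]))
  have hA : A.IsHermitian := (hM.block 0).isHermitian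
  have hC : C.IsHermitian := (hM.block 1).isHermitian
  have hα : T.reApplyInnerSelf (blockEmbedding n 0 v) = l - ‖_‖ :=
    reApplyInnerSelf_blockEmbedding_of_mem_topEigenvectors (blockMatrix A B Bᴴ C) (i := 0) hv
  have hβ : T.reApplyInnerSelf (blockEmbedding n 1 w) = l - ‖_‖ :=
    reApplyInnerSelf_blockEmbedding_of_mem_topEigenvectors (blockMatrix A B Bᴴ C) (i := 1) hw
  refine blockMatrix_mem_separableCone (hα ▸ h_pos 0 hv.1) (hβ ▸ h_pos 1 hw.1)
    (posSemidef_sub_smul_one hA l) (posSemidef_sub_smul_one hC l) ?_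
  rw [← l2_opNorm_toEuclideanCLM]
  refine lt_of_lt_of_eq ?_ (congrArg₂ (fun α β => √(α * β)) hα hβ)
  obtain hB | hB := eq_or_ne (toEuclideanCLM (𝕜 := ℂ) B) 0
  · rw [hB, norm_zero]
    exact Real.sqrt_pos.2 (mul_pos (h_pos 0 hv.1) (h_pos 1 hw.1))
  · rw [← re_inner_apply_of_mem_topSingularPairs hB hp]
    change (inner ℂ p.1 (toEuclideanCLM (𝕜 := ℂ)
      ((Matrix.comp _ _ _ _ _).symm (blockMatrix A B Bᴴ C) 0 1) p.2)).re < _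
    rw [← inner_blockEmbedding_toEuclideanCLM]
    exact hM.re_inner_lt_sqrt hb he hl (by rwa [finrank_euclideanSpace])
      (inner_blockEmbedding_of_ne zero_ne_one) hv.1 hw.1 (norm_fst_of_mem_topSingularPairs hB hp)
      (norm_snd_of_mem_topSingularPairs hB hp) h

/-- The operator `M` on `ℂ² ⊗ ℂⁿ` seen in the basis of `ℂ²` rotated by the angle `s`. -/
noncomputable def rotateBlocks (M : Matrix (Fin 2 × n) (Fin 2 × n) ℂ) (s : ℝ) :
    Matrix (Fin 2 × n) (Fin 2 × n) ℂ :=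
  ((rotationMatrix s).map Complex.ofReal ⊗ₖ 1)ᴴ * M * ((rotationMatrix s).map Complex.ofReal ⊗ₖ 1)

lemma map_rotationMatrix_mem_unitaryGroup (s : ℝ) :
    (rotationMatrix s).map Complex.ofReal ∈ unitaryGroup (Fin 2) ℂ := by
  have h_star : star ((rotationMatrix s).map Complex.ofReal) =
      (rotationMatrix s)ᵀ.map Complex.ofReal := by
    ext i j
    simp
  rw [mem_unitaryGroup_iff, h_star]
  exact (Matrix.map_mul (f := Complex.ofRealHom)).symm.trans (by
    rw [rotationMatrix_mul_transpose]; simp)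

lemma rotateBlocks_mem_separableCone_iff {M : Matrix (Fin 2 × n) (Fin 2 × n) ℂ} {s : ℝ} :
    rotateBlocks M s ∈ separableCone (Fin 2) n ↔ M ∈ separableCone (Fin 2) n :=
  conjTranspose_kronecker_mul_mul_mem_separableCone_iff
    (IsUnit.of_mul_eq_one _ (mem_unitaryGroup_iff.1 (map_rotationMatrix_mem_unitaryGroup s)))
    isUnit_one

lemma EigenvalueBounds.rotateBlocks {M : Matrix (Fin 2 × n) (Fin 2 × n) ℂ}
    (hM : EigenvalueBounds (toEuclideanCLM (𝕜 := ℂ) M) l b c e) (s : ℝ) :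
    EigenvalueBounds (toEuclideanCLM (𝕜 := ℂ) (rotateBlocks M s)) l b c e :=
  hM.unitary_conj (kronecker_mem_unitary (map_rotationMatrix_mem_unitaryGroup s) (one_mem _))

lemma continuous_rotationMatrix : Continuous rotationMatrix := continuous_matrix fun i j => by
  fin_cases i <;> fin_cases j
  exacts [Real.continuous_cos, Real.continuous_sin, Real.continuous_sin.neg, Real.continuous_cos]

lemma continuous_rotateBlocks (M : Matrix (Fin 2 × n) (Fin 2 × n) ℂ) :
    Continuous (rotateBlocks M) := by
  have h_rot : Continuous fun s => (rotationMatrix s).map Complex.ofReal ⊗ₖ (1 : Matrix n n ℂ) :=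
    continuous_matrix fun _ _ => (Complex.continuous_ofReal.comp
      (continuous_rotationMatrix.matrix_elem _ _)).mul continuous_const
  exact (h_rot.matrix_conjTranspose.matrix_mul continuous_const).matrix_mul h_rot

lemma continuous_toEuclideanCLM_block_rotateBlocks (M : Matrix (Fin 2 × n) (Fin 2 × n) ℂ)
    (i j : Fin 2) : Continuous fun s =>
      toEuclideanCLM (𝕜 := ℂ) ((Matrix.comp _ _ _ _ _).symm (rotateBlocks M s) i j) :=
  continuous_toEuclideanCLM.comp
    (continuous_matrix fun _ _ => (continuous_rotateBlocks M).matrix_elem _ _)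

lemma rotateBlocks_zero (M : Matrix (Fin 2 × n) (Fin 2 × n) ℂ) : rotateBlocks M 0 = M := by
  have h_one : (rotationMatrix 0).map Complex.ofReal = 1 := by
    ext i j
    fin_cases i <;> fin_cases j <;> simp [rotationMatrix]
  simp [rotateBlocks, h_one]

lemma comp_symm_rotateBlocks_pi_div_two (M : Matrix (Fin 2 × n) (Fin 2 × n) ℂ) :
    (Matrix.comp _ _ _ _ _).symm (rotateBlocks M (Real.pi / 2)) =
    !![(Matrix.comp _ _ _ _ _).symm M 1 1, -(Matrix.comp _ _ _ _ _).symm M 1 0;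
      -(Matrix.comp _ _ _ _ _).symm M 0 1, (Matrix.comp _ _ _ _ _).symm M 0 0] := by
  ext i j : 2
  rw [rotateBlocks, comp_symm_conjTranspose_kronecker_mul_mul]
  fin_cases i <;> fin_cases j <;> simp [rotationMatrix]

/- A suitable rotation of the qubit basis matches the angles of the top vectors of the blocks. -/
theorem mem_separableCone_of_eigenvalueBounds {M : Matrix (Fin 2 × n) (Fin 2 × n) ℂ}
    (hM : EigenvalueBounds (toEuclideanCLM (𝕜 := ℂ) M) l b c e) (hb : 0 ≤ b) (he : 0 < e)
    (hl : l < c + 2 * √(b * e)) (hn : 1 < Fintype.card n) : M ∈ separableCone (Fin 2) n := by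
  have : Nonempty n := Fintype.card_pos_iff.1 (zero_lt_one.trans hn)
  have : ConnectedSpace (Set.Icc 0 (Real.pi / 2)) :=
    Subtype.connectedSpace (isConnected_Icc Real.pi_div_two_pos.le)
  let block (s : Set.Icc 0 (Real.pi / 2)) (i j : Fin 2) :=
    toEuclideanCLM (𝕜 := ℂ) ((Matrix.comp _ _ _ _ _).symm (rotateBlocks M s) i j)
  have h_cont (i j : Fin 2) : Continuous fun s => block s i j :=
    (continuous_toEuclideanCLM_block_rotateBlocks M i j).comp continuous_subtype_val
  have h_pos (i : Fin 2) (s) : ((l : ℂ) • 1 - block s i i).IsPositive :=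
    ((hM.rotateBlocks s).block i).isPositive_smul_one_sub
  have h_zero : rotateBlocks M 0 = M := rotateBlocks_zero M
  have h_quarter := comp_symm_rotateBlocks_pi_div_two M
  have h_adj : toEuclideanCLM (𝕜 := ℂ) ((Matrix.comp _ _ _ _ _).symm M 1 0) =
      ContinuousLinearMap.adjoint
        (toEuclideanCLM (𝕜 := ℂ) ((Matrix.comp _ _ _ _ _).symm M 0 1)) := by
    rw [← conjTranspose_comp_symm_of_isHermitian hM.isHermitian]
    exact map_star _ _
  obtain ⟨s, v, hv, w, hw, p, hp, h⟩ := exists_topVectors_norm_inner_eq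
    (P := fun s => (l : ℂ) • 1 - block s 0 0) (P' := fun s => (l : ℂ) • 1 - block s 1 1)
    (B := fun s => block s 0 1) (continuous_const.sub (h_cont 0 0))
    (continuous_const.sub (h_cont 1 1)) (h_cont 0 1) (h_pos 0) (h_pos 1)
    (s₀ := ⟨0, by simp [Real.pi_div_two_pos.le]⟩)
    (s₁ := ⟨Real.pi / 2, by simp [Real.pi_div_two_pos.le]⟩)
    (by simp [block, h_zero, h_quarter]) (by simp [block, h_zero, h_quarter])
    (by simp [block, h_zero, h_quarter, h_adj])
  have h_eq := eq_blockMatrix_of_isHermitian (hM.rotateBlocks s).isHermitian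
  rw [← rotateBlocks_mem_separableCone_iff (s := s), h_eq]
  exact blockMatrix_mem_separableCone_of_topVectors (h_eq ▸ hM.rotateBlocks s) hb he hl hn
    hv hw hp h

end Separability

section ProductStates

open Matrix

variable {m n : Type} [Fintype m] [Fintype n]

/-- The density matrices of the product states of a bipartite system. -/
abbrev productStates (m n : Type) [Fintype m] [Fintype n] : Set (Matrix (m × n) (m × n) ℂ) :=
  {τ | ∃ (α : QState m) (β : QState n), τ = α.1 ⊗ₖ β.1}

lemma exists_smul_state_of_posSemidef {P : Matrix m m ℂ} (hP : P.PosSemidef) (hP0 : P ≠ 0) :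
    ∃ t : ℝ, 0 < t ∧ ∃ α : QState m, P = t • α.1 := by
  obtain ⟨t, ht, (h_trace : (t : ℂ) = P.trace)⟩ := RCLike.nonneg_iff_exists_ofReal.1 hP.trace_nonneg
  have ht0 : t ≠ 0 := fun h => hP0 (hP.trace_eq_zero_iff.1 (by rw [← h_trace, h]; simp))
  refine ⟨t, ht.lt_of_ne' ht0, ⟨t⁻¹ • P, hP.smul (inv_nonneg.2 ht), ?_⟩, ?_⟩
  · rw [trace_smul, ← h_trace, Complex.real_smul, ← Complex.ofReal_mul, inv_mul_cancel₀ ht0,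
      Complex.ofReal_one]
  · rw [smul_inv_smul₀ ht0]

lemma eq_zero_or_exists_smul_of_mem_separableCone {M : Matrix (m × n) (m × n) ℂ}
    (hM : M ∈ separableCone m n) :
    M = 0 ∨ ∃ t : ℝ, 0 < t ∧ ∃ N ∈ convexHull ℝ (productStates m n), M = t • N := by
  induction hM using AddSubmonoid.closure_induction with
  | mem M hM =>
    obtain ⟨P, Q, hP, hQ, rfl⟩ := hM
    obtain rfl | hP0 := eq_or_ne P 0
    · exact .inl (zero_kronecker Q)
    obtain rfl | hQ0 := eq_or_ne Q 0
    · exact .inl (kronecker_zero P)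
    obtain ⟨s, hs, α, rfl⟩ := exists_smul_state_of_posSemidef hP hP0
    obtain ⟨t, ht, β, rfl⟩ := exists_smul_state_of_posSemidef hQ hQ0
    refine .inr ⟨s * t, mul_pos hs ht, _, subset_convexHull _ _ ⟨α, β, rfl⟩, ?_⟩
    rw [smul_kronecker, kronecker_smul, smul_smul]
  | zero => exact .inl rfl
  | add M N _ _ hM hN =>
    obtain rfl | ⟨s, hs, M, hM, rfl⟩ := hM
    · simpa using hN
    obtain rfl | ⟨t, ht, N, hN, rfl⟩ := hN
    · exact .inr ⟨s, hs, M, hM, add_zero _⟩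
    refine .inr ⟨s + t, add_pos hs ht, (s / (s + t)) • M + (t / (s + t)) • N,
      convex_convexHull ℝ _ hM hN (by positivity) (by positivity) (by field_simp), ?_⟩
    rw [smul_add, smul_smul, smul_smul, mul_div_cancel₀ _ (add_pos hs ht).ne',
      mul_div_cancel₀ _ (add_pos hs ht).ne']

lemma trace_eq_one_of_mem_convexHull_productStates {M : Matrix (m × n) (m × n) ℂ}
    (hM : M ∈ convexHull ℝ (productStates m n)) : M.trace = 1 := by
  refine convexHull_min ?_ ((convex_singleton (1 : ℂ)).is_linear_preimage
    (IsLinearMap.mk (f := trace) trace_add trace_smul)) hM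
  rintro _ ⟨α, β, rfl⟩
  simp [trace_kronecker, α.2.2, β.2.2]

lemma isSeparable_of_mem_separableCone {ρ : QState (m × n)} (hρ : ρ.1 ∈ separableCone m n) :
    QIsSeparable ρ := by
  have h_trace := ρ.2.2
  obtain h0 | ⟨t, _, N, hN, h_eq⟩ := eq_zero_or_exists_smul_of_mem_separableCone hρ
  · simp [h0] at h_trace
  · rw [h_eq, trace_smul, trace_eq_one_of_mem_convexHull_productStates hN] at h_trace
    have ht : t = 1 := by simpa using h_trace
    rw [QIsSeparable, h_eq, ht, one_smul]
    exact hN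

end ProductStates

section Eigenvalues

open Matrix

variable {d : ℕ}

lemma decEig_antitone (ρ : QState (Fin 2 × Fin d)) : Antitone (decEig ρ) := fun i j hij =>
  ρ.2.1.isHermitian.eigenvalues₀_antitone (show Fin.cast _ i ≤ Fin.cast _ j from hij)

/-- The bijection through which `Matrix.IsHermitian.eigenvalues` is defined from
`Matrix.IsHermitian.eigenvalues₀`: it carries the position of an eigenvalue in the decreasing order
to the basis vector that indexes it. -/
noncomputable def eigenIndex (d : ℕ) : Fin (2 * d) ≃ Fin 2 × Fin d :=
  (finCongr (by simp)).trans (Fintype.equivOfCardEq (Fintype.card_fin _))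

lemma eigenvalues_eigenIndex (ρ : QState (Fin 2 × Fin d)) (k : Fin (2 * d)) :
    ρ.2.1.isHermitian.eigenvalues (eigenIndex d k) = decEig ρ k := by
  simp only [IsHermitian.eigenvalues, decEig, eigenIndex, Equiv.trans_apply, finCongr_apply,
    Equiv.symm_apply_apply]

lemma decEig_nonneg (ρ : QState (Fin 2 × Fin d)) (k : Fin (2 * d)) : 0 ≤ decEig ρ k :=
  eigenvalues_eigenIndex ρ k ▸ ρ.2.1.eigenvalues_nonneg _

lemma eigenvalueBounds_decEig (ρ : QState (Fin 2 × Fin d)) {i j k n : Fin (2 * d)}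
    (hi : (i : ℕ) = 0) (hj : (j : ℕ) + 3 = 2 * d) (hk : (k : ℕ) + 2 = 2 * d)
    (hn : (n : ℕ) + 1 = 2 * d) :
    EigenvalueBounds (toEuclideanCLM (𝕜 := ℂ) ρ.1) (decEig ρ i) (decEig ρ j) (decEig ρ k)
      (decEig ρ n) := by
  refine .of_eigenbasis (ρ.2.1.isHermitian.eigenvectorBasis.reindex (eigenIndex d).symm)
    (decEig_antitone ρ) (fun a => ?_) hi hj hk hn
  rw [OrthonormalBasis.reindex_apply, Equiv.symm_symm, ← eigenvalues_eigenIndex]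
  exact WithLp.ofLp_injective 2 (ρ.2.1.isHermitian.mulVec_eigenvectorBasis _)

end Eigenvalues

section Interior

open Matrix

variable {d : ℕ} {l b c e : ℝ}

lemma mem_absSep_of_eigenvalueBounds (hd : 2 ≤ d) {ρ : QState (Fin 2 × Fin d)}
    (hρ : EigenvalueBounds (toEuclideanCLM (𝕜 := ℂ) ρ.1) l b c e) (hb : 0 ≤ b) (he : 0 < e)
    (hl : l < c + 2 * √(b * e)) : ρ ∈ absSep d := fun U => by
  have h_conj := hρ.unitary_conj (star U).2
  rw [Unitary.coe_star, star_eq_conjTranspose, conjTranspose_conjTranspose] at h_conj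
  exact isSeparable_of_mem_separableCone
    (mem_separableCone_of_eigenvalueBounds h_conj hb he hl (by simpa only [Fintype.card_fin]))

lemma exists_pos_lt_sub_add_two_mul_sqrt (hb : 0 < b) (he : 0 < e) (hl : l < c + 2 * √(b * e)) :
    ∃ η > 0, 0 < b - η ∧ 0 < e - η ∧ l + η < c - η + 2 * √((b - η) * (e - η)) := by
  have h_nhds : ∀ᶠ η in nhds (0 : ℝ), 0 < b - η ∧ 0 < e - η ∧
      l + η < c - η + 2 * √((b - η) * (e - η)) := by
    refine .and ?_ (.and ?_ ?_) <;>
      exact ContinuousAt.eventually_lt (by fun_prop) (by fun_prop) (by simpa)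
  obtain ⟨η, h, hη⟩ := ((h_nhds.filter_mono nhdsWithin_le_nhds).and
    (self_mem_nhdsWithin (s := Set.Ioi 0))).exists
  exact ⟨η, hη, h⟩

lemma mem_interior_absSep_of_eigenvalueBounds (hd : 2 ≤ d) {ρ : QState (Fin 2 × Fin d)}
    (hρ : EigenvalueBounds (toEuclideanCLM (𝕜 := ℂ) ρ.1) l b c e) (hb : 0 < b) (he : 0 < e)
    (hl : l < c + 2 * √(b * e)) : ρ ∈ interior (absSep d) := by
  obtain ⟨η, hη, hbη, heη, hlη⟩ := exists_pos_lt_sub_add_two_mul_sqrt hb he hl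
  have h_cont : Continuous fun τ : QState (Fin 2 × Fin d) =>
      ‖toEuclideanCLM (𝕜 := ℂ) τ.1 - toEuclideanCLM (𝕜 := ℂ) ρ.1‖ :=
    ((continuous_toEuclideanCLM.comp continuous_subtype_val).sub continuous_const).norm
  have h_open : IsOpen {τ : QState (Fin 2 × Fin d) |
      ‖toEuclideanCLM (𝕜 := ℂ) τ.1 - toEuclideanCLM (𝕜 := ℂ) ρ.1‖ < η} :=
    isOpen_lt h_cont continuous_const
  refine mem_interior.2 ⟨_, fun τ hτ => ?_, h_open, ?_⟩
  · exact mem_absSep_of_eigenvalueBounds hd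
      (hρ.perturb (isSymmetric_toEuclideanCLM_iff.2 τ.2.1.isHermitian) (le_of_lt hτ)) hbη.le heη hlη
  · simpa only [Set.mem_ofPred_eq, sub_self, norm_zero] using hη

lemma mem_interior_absSep_of_decEig_lt (hd : 2 ≤ d) {ρ : QState (Fin 2 × Fin d)}
    {i j k n : Fin (2 * d)}
    (h_lt : decEig ρ i - decEig ρ k < 2 * √(decEig ρ j * decEig ρ n)) (hi : (i : ℕ) = 0)
    (hj : (j : ℕ) + 3 = 2 * d) (hk : (k : ℕ) + 2 = 2 * d) (hn : (n : ℕ) + 1 = 2 * d) :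
    ρ ∈ interior (absSep d) := by
  have h_le : decEig ρ k ≤ decEig ρ i := decEig_antitone ρ (Fin.le_def.2 (by omega))
  have h_mul := Real.sqrt_pos.1
    (pos_of_mul_pos_right ((sub_nonneg.2 h_le).trans_lt h_lt) zero_le_two)
  exact mem_interior_absSep_of_eigenvalueBounds hd (eigenvalueBounds_decEig ρ hi hj hk hn)
    (pos_of_mul_pos_left h_mul (decEig_nonneg ρ _)) (pos_of_mul_pos_right h_mul (decEig_nonneg ρ _))
    (by linarith)

end Interior

section Compactness

open Matrix

lemma convexHull_range_eq_image_stdSimplex {ι E : Type*} [Fintype ι] [AddCommGroup E] [Module ℝ E]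
    (z : ι → E) :
    convexHull ℝ (Set.range z) = (fun w : ι → ℝ => ∑ i, w i • z i) '' stdSimplex ℝ ι := by
  classical
  have h_range : Set.range z =
      Fintype.linearCombination ℝ z '' Set.range fun i => Pi.single i (1 : ℝ) := by
    rw [← Set.range_comp]
    exact congrArg Set.range (funext fun i => by simp)
  rw [h_range, ← LinearMap.image_convexHull, convexHull_rangle_single_eq_stdSimplex]
  rfl

lemma mem_convexHull_iff_exists_fin {E : Type*} [AddCommGroup E] [Module ℝ E]
    [FiniteDimensional ℝ E] {s : Set E} {x : E} :
    x ∈ convexHull ℝ s ↔ ∃ z : Fin (Module.finrank ℝ E + 1) → E,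
      (∀ i, z i ∈ s) ∧ x ∈ convexHull ℝ (Set.range z) := by
  refine ⟨fun hx => ?_, fun ⟨z, hz, hx⟩ => convexHull_mono (Set.range_subset_iff.2 hz) hx⟩
  rw [convexHull_eq_union] at hx
  simp only [Set.mem_iUnion] at hx
  obtain ⟨t, hts, h_ind, hx⟩ := hx
  have : Nonempty t := (convexHull_nonempty_iff.1 ⟨x, hx⟩).to_subtype
  have h_card : Fintype.card t ≤ Module.finrank ℝ E + 1 :=
    h_ind.card_le_finrank_succ.trans (Nat.succ_le_succ (Submodule.finrank_le _))
  obtain ⟨f⟩ : Nonempty (t ↪ Fin (Module.finrank ℝ E + 1)) :=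
    Function.Embedding.nonempty_of_card_le (by rwa [Fintype.card_fin])
  refine ⟨Subtype.val ∘ Function.invFun f, fun i => hts (Subtype.coe_prop _), ?_⟩
  rwa [(Function.invFun_surjective f.injective).range_comp, Subtype.range_coe]

lemma isCompact_convexHull_of_isCompact {E : Type*} [AddCommGroup E] [Module ℝ E]
    [TopologicalSpace E] [IsTopologicalAddGroup E] [ContinuousSMul ℝ E] [FiniteDimensional ℝ E]
    {s : Set E} (hs : IsCompact s) : IsCompact (convexHull ℝ s) := by
  let N := Module.finrank ℝ E + 1
  have h_image : convexHull ℝ s = (fun p : (Fin N → ℝ) × (Fin N → E) => ∑ i, p.1 i • p.2 i) ''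
      (stdSimplex ℝ (Fin N) ×ˢ Set.univ.pi fun _ => s) := by
    ext x
    simp only [mem_convexHull_iff_exists_fin, convexHull_range_eq_image_stdSimplex, Set.mem_image,
      Set.mem_prod, Set.mem_univ_pi, Prod.exists]
    exact ⟨fun ⟨z, hz, w, hw, hx⟩ => ⟨w, z, ⟨hw, hz⟩, hx⟩,
      fun ⟨w, z, ⟨hw, hz⟩, hx⟩ => ⟨z, hz, w, hw, hx⟩⟩
  rw [h_image]
  exact ((isCompact_stdSimplex ℝ (Fin N)).prod (isCompact_univ_pi fun _ => hs)).image (by fun_prop)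

lemma norm_sq_apply_le_of_posSemidef {n : Type*} {M : Matrix n n ℂ} (hM : M.PosSemidef) (i j : n) :
    ‖M i j‖ ^ 2 ≤ (M i i).re * (M j j).re := by
  have h_det := (hM.submatrix ![i, j]).det_nonneg
  have h_diag (k : n) : M k k = (M k k).re := Complex.eq_re_of_ofReal_le hM.diag_nonneg
  rw [det_fin_two] at h_det
  simp only [submatrix_apply, cons_val_zero, cons_val_one] at h_det
  rw [← hM.isHermitian.apply j i, Complex.star_def, Complex.mul_conj', h_diag i, h_diag j] at h_det
  exact sub_nonneg.1 (by exact_mod_cast h_det)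

lemma apply_eq_zero_of_posSemidef {n : Type*} {M : Matrix n n ℂ} (hM : M.PosSemidef) {i : n}
    (hi : M i i = 0) (j : n) : M i j = 0 := by
  have h_le := norm_sq_apply_le_of_posSemidef hM i j
  rw [hi, Complex.zero_re, zero_mul] at h_le
  exact norm_eq_zero.1 (pow_eq_zero_iff two_ne_zero |>.1 (h_le.antisymm (sq_nonneg _)))

variable {n : Type} [Fintype n]

lemma norm_state_apply_le_one (ρ : QState n) (i j : n) : ‖ρ.1 i j‖ ≤ 1 := by
  have h_nonneg (k : n) : 0 ≤ (ρ.1 k k).re := (Complex.nonneg_iff.1 ρ.2.1.diag_nonneg).1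
  have h_le (k : n) : (ρ.1 k k).re ≤ 1 := by
    calc (ρ.1 k k).re ≤ ∑ k, (ρ.1 k k).re :=
          Finset.single_le_sum (fun k _ => h_nonneg k) (Finset.mem_univ k)
      _ = ρ.1.trace.re := (Complex.re_sum _ _).symm
      _ = 1 := by rw [ρ.2.2, Complex.one_re]
  refine (sq_le_one_iff₀ (norm_nonneg _)).1 ?_
  exact (norm_sq_apply_le_of_posSemidef ρ.2.1 i j).trans
    (mul_le_one₀ (h_le i) (h_nonneg j) (h_le j))

open scoped Matrix.Norms.L2Operator MatrixOrder in
lemma isClosed_setOf_posSemidef {n : Type*} [Finite n] :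
    IsClosed {M : Matrix n n ℂ | M.PosSemidef} := by
  classical
  cases nonempty_fintype n
  simpa only [nonneg_iff_posSemidef] using CStarAlgebra.isClosed_nonneg (A := Matrix n n ℂ)

lemma isCompact_setOf_state : IsCompact {ρ : Matrix n n ℂ | ρ.PosSemidef ∧ ρ.trace = 1} := by
  have h_box : IsCompact (X := Matrix n n ℂ)
      (Set.univ.pi fun _ => Set.univ.pi fun _ => Metric.closedBall 0 1) :=
    isCompact_univ_pi fun _ => isCompact_univ_pi fun _ => isCompact_closedBall _ _
  refine h_box.of_isClosed_subset (isClosed_setOf_posSemidef.inter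
    (isClosed_eq (by fun_prop) continuous_const)) fun ρ hρ i _ j _ => ?_
  simpa using norm_state_apply_le_one ⟨ρ, hρ⟩ i j

instance : CompactSpace (QState n) := isCompact_iff_compactSpace.1 isCompact_setOf_state

lemma isCompact_productStates {m : Type} [Fintype m] : IsCompact (productStates m n) := by
  have h_range : productStates m n = Set.range fun p : QState m × QState n => p.1.1 ⊗ₖ p.2.1 := by
    ext τ
    simp [eq_comm]
  rw [h_range]
  refine isCompact_range (continuous_matrix fun i j => ?_)
  simp only [kroneckerMap_apply]
  exact ((continuous_subtype_val.comp continuous_fst).matrix_elem _ _).mul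
    ((continuous_subtype_val.comp continuous_snd).matrix_elem _ _)

lemma isClosed_setOf_isSeparable {m : Type} [Fintype m] :
    IsClosed {ρ : QState (m × n) | QIsSeparable ρ} :=
  (isCompact_convexHull_of_isCompact isCompact_productStates).isClosed.preimage
    continuous_subtype_val

lemma continuous_conj [DecidableEq n] (U : unitaryGroup n ℂ) :
    Continuous fun ρ : QState n => ρ.conj U :=
  Continuous.subtype_mk (by fun_prop) _

lemma isClosed_absSep (d : ℕ) : IsClosed (absSep d) := by
  have h_eq : absSep d = ⋂ U, (fun ρ => ρ.conj U) ⁻¹' {ρ | QIsSeparable ρ} := by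
    ext ρ
    simp [absSep]
  rw [h_eq]
  exact isClosed_iInter fun U => isClosed_setOf_isSeparable.preimage (continuous_conj U)

end Compactness

section Boundary

open Matrix

/-- The partial transpose, with respect to the second factor, of an operator on `ℂᵐ ⊗ ℂⁿ`. -/
def partialTranspose {m n : Type*} (M : Matrix (m × n) (m × n) ℂ) : Matrix (m × n) (m × n) ℂ :=
  of fun p q => M (p.1, q.2) (q.1, p.2)

variable {m n : Type} [Fintype m] [Fintype n]

lemma posSemidef_partialTranspose_of_isSeparable {ρ : QState (m × n)} (hρ : QIsSeparable ρ) :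
    (partialTranspose ρ.1).PosSemidef := by
  have h_convex : Convex ℝ {M : Matrix (m × n) (m × n) ℂ | (partialTranspose M).PosSemidef} :=
    fun M hM N hN s t hs ht _ => (hM.smul hs).add (hN.smul ht)
  refine convexHull_min ?_ h_convex hρ
  rintro _ ⟨α, β, rfl⟩
  exact α.2.1.kronecker β.2.1.transpose

lemma apply_eq_zero_of_isSeparable {ρ : QState (m × n)} (hρ : QIsSeparable ρ) {i : m} {a : n}
    (h : ρ.1 (i, a) (i, a) = 0) (j : m) (b : n) : ρ.1 (i, b) (j, a) = 0 :=
  apply_eq_zero_of_posSemidef (posSemidef_partialTranspose_of_isSeparable hρ) (i := (i, a)) h (j, b)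

lemma exists_mem_of_mem_interior {S : Set (QState n)} {σ : QState n} (hσ : σ ∈ interior S)
    {γ : ℝ → Matrix n n ℂ} (hγ : Continuous γ) (h0 : γ 0 = σ.1) {r : ℝ} (hr : 0 < r)
    (h_state : ∀ t ∈ Set.Ioo 0 r, (γ t).PosSemidef ∧ (γ t).trace = 1) :
    ∃ t ∈ Set.Ioo 0 r, ∃ τ ∈ S, τ.1 = γ t := by
  rw [mem_interior_iff_mem_nhds, nhds_subtype_eq_comap, Filter.mem_comap, ← h0] at hσ
  obtain ⟨V, hV, hVS⟩ := hσ
  have h_mem : ∀ᶠ t in nhdsWithin (0 : ℝ) (Set.Ioi 0), γ t ∈ V :=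
    (hγ.continuousAt.eventually hV).filter_mono nhdsWithin_le_nhds
  obtain ⟨t, htV, ht⟩ := (h_mem.and (Ioo_mem_nhdsGT hr)).exists
  exact ⟨t, ht, ⟨γ t, h_state t ht⟩, hVS htV, rfl⟩

lemma exists_state_apply_eq_zero {i j : m} {a b : n} (hij : i ≠ j) (hab : a ≠ b) :
    ∃ κ : QState (m × n), κ.1 (i, a) (i, a) = 0 ∧ κ.1 (i, b) (j, a) ≠ 0 := by
  classical
  let φ : m × n → ℂ := Pi.single (i, b) 1 + Pi.single (j, a) 1
  have h_trace : (vecMulVec φ (star φ)).trace = 2 := by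
    simp [φ, trace_vecMulVec, hij, hab, one_add_one_eq_two]
  refine ⟨⟨(2⁻¹ : ℝ) • vecMulVec φ (star φ), (posSemidef_vecMulVec_self_star φ).smul (by norm_num),
    by rw [trace_smul, h_trace, Complex.real_smul]; norm_num⟩, ?_, ?_⟩
  · simp [φ, vecMulVec_apply, hij, hab]
  · simp [φ, vecMulVec_apply, hij, hab]

/- Adding a multiple of the maximally entangled state of the levels `i, j` and `a, b` makes the
partial transpose indefinite. -/
lemma notMem_interior_setOf_isSeparable {σ : QState (m × n)} {i j : m} {a b : n} (hij : i ≠ j)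
    (hab : a ≠ b) (h_diag : σ.1 (i, a) (i, a) = 0) (h_off : σ.1 (i, b) (j, a) = 0) :
    σ ∉ interior {ρ | QIsSeparable ρ} := by
  intro hσ
  obtain ⟨κ, hκ_diag, hκ_off⟩ := exists_state_apply_eq_zero hij hab
  obtain ⟨t, ht, τ, hτ, hτ_eq⟩ := exists_mem_of_mem_interior hσ
    (γ := fun t => (1 - t) • σ.1 + t • κ.1) (by fun_prop) (by simp) one_pos fun t ht => by
      refine ⟨(σ.2.1.smul (sub_nonneg.2 ht.2.le)).add (κ.2.1.smul ht.1.le), ?_⟩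
      rw [trace_add, trace_smul, trace_smul, σ.2.2, κ.2.2, ← add_smul, sub_add_cancel, one_smul]
  have h_zero := apply_eq_zero_of_isSeparable hτ (i := i) (a := a)
    (by simp [hτ_eq, h_diag, hκ_diag]) j b
  simp [hτ_eq, h_off, hκ_off, ht.1.ne'] at h_zero

lemma conj_conj [DecidableEq n] (U V : unitaryGroup n ℂ) (ρ : QState n) :
    (ρ.conj V).conj U = ρ.conj (U * V) :=
  Subtype.ext (by simp [QState.conj, conjTranspose_mul, Matrix.mul_assoc])

lemma conj_one [DecidableEq n] (ρ : QState n) : ρ.conj 1 = ρ :=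
  Subtype.ext (by simp [QState.conj])

variable {d : ℕ}

lemma absSep_subset_setOf_isSeparable : absSep d ⊆ {ρ | QIsSeparable ρ} := fun ρ hρ =>
  conj_one ρ ▸ hρ 1

lemma conj_mem_absSep {ρ : QState (Fin 2 × Fin d)} (hρ : ρ ∈ absSep d)
    (V : unitaryGroup (Fin 2 × Fin d) ℂ) : ρ.conj V ∈ absSep d := fun U => by
  rw [conj_conj]
  exact hρ (U * V)

lemma conj_mem_interior_absSep {σ : QState (Fin 2 × Fin d)} (hσ : σ ∈ interior (absSep d))
    (V : unitaryGroup (Fin 2 × Fin d) ℂ) : σ.conj V ∈ interior (absSep d) := by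
  have h_subset : (fun ρ => ρ.conj V⁻¹) ⁻¹' absSep d ⊆ absSep d := fun ρ hρ => by
    simpa only [conj_conj, mul_inv_cancel, conj_one] using conj_mem_absSep hρ V
  refine interior_mono h_subset
    (preimage_interior_subset_interior_preimage (continuous_conj V⁻¹) ?_)
  rwa [Set.mem_preimage, conj_conj, inv_mul_cancel, conj_one]

lemma posDef_of_mem_interior_absSep (hd : 2 ≤ d) {σ : QState (Fin 2 × Fin d)}
    (hσ : σ ∈ interior (absSep d)) : σ.1.PosDef := by
  have : Nontrivial (Fin d) := Fin.nontrivial_iff_two_le.2 hd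
  have hH := σ.2.1.isHermitian
  refine hH.posDef_iff_eigenvalues_pos.2 fun ⟨i, a⟩ => (σ.2.1.eigenvalues_nonneg _).lt_of_ne' ?_
  intro h_zero
  obtain ⟨j, hj⟩ := exists_ne i
  obtain ⟨b, hb⟩ := exists_ne a
  have h_diag : (σ.conj (star hH.eigenvectorUnitary)).1 =
      diagonal (RCLike.ofReal ∘ hH.eigenvalues) := by
    rw [← hH.conjStarAlgAut_star_eigenvectorUnitary, Unitary.conjStarAlgAut_apply]
    rfl
  refine notMem_interior_setOf_isSeparable hj.symm hb.symm ?_ ?_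
    (interior_mono absSep_subset_setOf_isSeparable
      (conj_mem_interior_absSep hσ (star hH.eigenvectorUnitary)))
  · simp [h_diag, h_zero]
  · simp [h_diag, hj.symm]

open scoped Matrix.Norms.L2Operator MatrixOrder in
lemma exists_pos_posSemidef_sub_smul_one {n : Type*} [Finite n] [DecidableEq n] {M : Matrix n n ℂ}
    (hM : M.PosDef) : ∃ r : ℝ, 0 < r ∧ (M - r • 1).PosSemidef := by
  cases nonempty_fintype n
  cases subsingleton_or_nontrivial (Matrix n n ℂ)
  · refine ⟨1, one_pos, ?_⟩
    rw [Subsingleton.elim (M - (1 : ℝ) • 1) 0]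
    exact .zero
  · obtain ⟨r, hr, h_le⟩ := (CFC.exists_pos_algebraMap_le_iff hM.isHermitian).2
      fun x hx => hM.isStrictlyPositive.spectrum_pos hx
    exact ⟨r, hr, by rwa [Algebra.algebraMap_eq_smul_one, Matrix.le_iff] at h_le⟩

lemma trace_maxMixed (hd : d ≠ 0) : (maxMixed d).trace = 1 := by
  rw [maxMixed, trace_smul, trace_one, Complex.real_smul, Fintype.card_prod, Fintype.card_fin,
    Fintype.card_fin]
  push_cast
  exact inv_mul_cancel₀ (by simpa using hd)

lemma exists_mem_absSep_eq_maxMixed_add_smul (hd : 2 ≤ d) {σ : QState (Fin 2 × Fin d)}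
    (hσ : σ ∈ interior (absSep d)) :
    ∃ t > (0 : ℝ), ∃ τ ∈ absSep d, τ.1 = maxMixed d + (1 + t) • (σ.1 - maxMixed d) := by
  obtain ⟨r, hr, h_psd⟩ :=
    exists_pos_posSemidef_sub_smul_one (posDef_of_mem_interior_absSep hd hσ)
  have hd0 : d ≠ 0 := by omega
  have h_dim : (0 : ℝ) < 2 * d := by positivity
  obtain ⟨t, ht, τ, hτ, hτ_eq⟩ := exists_mem_of_mem_interior hσ
    (γ := fun t => maxMixed d + (1 + t) • (σ.1 - maxMixed d)) (by fun_prop) (by simp)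
    (mul_pos hr h_dim) fun t ht => by
      have h_eq : maxMixed d + (1 + t) • (σ.1 - maxMixed d) =
          (σ.1 - r • 1) + (t • σ.1 + (r - t * (2 * d : ℝ)⁻¹) • 1) := by
        rw [maxMixed]
        module
      constructor
      · rw [h_eq]
        refine h_psd.add ((σ.2.1.smul ht.1.le).add (PosSemidef.one.smul (sub_nonneg.2 ?_)))
        exact (mul_inv_le_iff₀ h_dim).2 ht.2.le
      · rw [trace_add, trace_smul, trace_sub, trace_maxMixed hd0, σ.2.2]
        simp
  exact ⟨t, ht.1, τ, hτ, hτ_eq⟩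

lemma isCompact_setOf_maxMixed_add_smul_mem_absSep {X : Matrix (Fin 2 × Fin d) (Fin 2 × Fin d) ℂ}
    (hX : X ≠ 0) : IsCompact {s : ℝ | ∃ τ ∈ absSep d, τ.1 = maxMixed d + s • X} := by
  have h_embedding : Topology.IsClosedEmbedding fun s : ℝ => maxMixed d + s • X :=
    (Homeomorph.addLeft (maxMixed d)).isClosedEmbedding.comp (isClosedEmbedding_smul_left hX)
  exact h_embedding.isCompact_preimage
    ((isClosed_absSep d).isCompact.image continuous_subtype_val)

lemma exists_mem_frontier_absSep (hd : 2 ≤ d) {ρ : QState (Fin 2 × Fin d)} (hρ : ρ ∈ absSep d)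
    (hne : ρ.1 ≠ maxMixed d) :
    ∃ s ≥ (1 : ℝ), ∃ σ ∈ absSep d, σ ∈ frontier (absSep d) ∧
      σ.1 = maxMixed d + s • (ρ.1 - maxMixed d) := by
  obtain ⟨s, ⟨σ, hσ, hσ_eq⟩, hs_max⟩ := (isCompact_setOf_maxMixed_add_smul_mem_absSep
    (sub_ne_zero.2 hne)).exists_isGreatest ⟨1, ρ, hρ, by simp⟩
  have hs : 1 ≤ s := hs_max ⟨ρ, hρ, by simp⟩
  refine ⟨s, hs, σ, hσ, (isClosed_absSep d).frontier_eq ▸ ⟨hσ, fun h_int => ?_⟩, hσ_eq⟩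
  obtain ⟨t, ht, τ, hτ, hτ_eq⟩ := exists_mem_absSep_eq_maxMixed_add_smul hd h_int
  have h_le : (1 + t) * s ≤ s :=
    hs_max ⟨τ, hτ, by rw [hτ_eq, hσ_eq, add_sub_cancel_left, smul_smul]⟩
  nlinarith

end Boundary

theorem corollary2 (d : ℕ) (hd : 2 ≤ d) (ρ : QState (Fin 2 × Fin d))
    (hρ : ρ ∈ absSep d) (hne : ρ.1 ≠ maxMixed d)
    (hlt : decEig ρ ⟨0, by omega⟩ - decEig ρ ⟨2 * d - 2, by omega⟩ <
      2 * √(decEig ρ ⟨2 * d - 3, by omega⟩ * decEig ρ ⟨2 * d - 1, by omega⟩)) :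
    (∃ σ : QState (Fin 2 × Fin d), σ ∈ absSep d ∧ σ ∈ frontier (absSep d) ∧
      ∃ t : ℝ, 0 < t ∧ t < 1 ∧ ρ.1 = t • maxMixed d + (1 - t) • σ.1) ∧
    ρ ∈ interior (absSep d) := by
  have h_int : ρ ∈ interior (absSep d) :=
    mem_interior_absSep_of_decEig_lt hd hlt rfl (by lia) (by lia) (by lia)
  refine ⟨?_, h_int⟩
  obtain ⟨s, hs, σ, hσ, hσ_frontier, hσ_eq⟩ := exists_mem_frontier_absSep hd hρ hne
  have hs_one : s ≠ 1 := by
    rintro rfl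
    have h_eq : σ = ρ := Subtype.ext (by simpa using hσ_eq)
    exact hσ_frontier.2 (h_eq ▸ h_int)
  have hs_pos : 0 < s := zero_lt_one.trans_le hs
  refine ⟨σ, hσ, hσ_frontier, 1 - s⁻¹, sub_pos.2 (inv_lt_one_of_one_lt₀ (hs.lt_of_ne' hs_one)),
    sub_lt_self 1 (inv_pos.2 hs_pos), ?_⟩
  rw [hσ_eq, sub_sub_cancel, smul_add, inv_smul_smul₀ hs_pos.ne']
  module
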